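/- Let $\ell$ be an odd prime, let $F$ be a field of characteristic different from $\ell$, and let $E$ be an elliptic curve over $F$. Let $F^s$ be a separable closure of $F$, let $G_F=\mathrm{Gal}(F^s/F)$, let $F^{(\ell)}=F(\boldsymbol\mu_{\ell^\infty})\subseteq F^s$ be the field obtained from $F$ by adjoining all roots of unity of $\ell$-power order, and let $G_{F^{(\ell)}}=\mathrm{Gal}(F^s/F^{(\ell)})\subseteq G_F$. Write $E_n$ for the kernel of multiplication by $n$ on $E(F^s)$, let $T_\ell(E)=\varprojlim_m E_{\ell^m}$ be the Tate module, and let $\rho_{E,\ell}:G_F\to\mathrm{Aut}(E_\ell)\cong\mathrm{GL}_2(\mathbf F_\ell)$ be the mod $\ell$ representation. Suppose that $\rho_{E,\ell}(G_F)$ contains $\mathrm{SL}_2(\mathbf F_\ell)$, i.e. contains every automorphism of the $\mathbf F_\ell$-vector space $E_\ell$ of determinant $1$. Then: (1) $E$ is $\ell$-full, i.e. the $\mathbf Z_\ell[N]$-module $S=T_\ell(E)$, with $N=G_{F^{(\ell)}}$, is well-rounded: $S$ is free of finite rank $m$ over $\mathbf Z_\ell$ and satisfies the following conditions (equivalent to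 one another for such $S$): (i) the natural homomorphism $\mathbf Z_\ell[N]\to\mathrm{End}_{\mathbf Z_\ell}(S)$ is surjective; (ii) the $N$-module $S/\ell S$ over $\mathbf F_\ell$ is absolutely simple; (iii) the image of the natural homomorphism $\mathbf Z_\ell[N]\to\mathrm{End}_{\mathbf Q_\ell}(S\otimes_{\mathbf Z_\ell}\mathbf Q_\ell)$ is isomorphic, as a $\mathbf Z_\ell$-algebra, to the matrix ring $\mathrm M_m(\mathbf Z_\ell)$. (2) Equivalently (since $T_\ell(E)/\ell T_\ell(E)=E_\ell$), the $G_{F^{(\ell)}}$-module $E_\ell$ over $\mathbf F_\ell$ is absolutely simple, i.e. $K\otimes_{\mathbf F_\ell}E_\ell$ is a simple $K[G_{F^{(\ell)}}]$-module for every field extension $K$ of $\mathbf F_\ell$. -/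

import Mathlib

open scoped TensorProduct

noncomputable section

universe u v w

namespace EllFull

/-! ### Absolutely simple and well-rounded representations -/

/-- Extension of scalars of a representation along `k → K`: the group acts on `K ⊗ V` through the
second factor. -/
def baseChangeRep {k : Type u} {N : Type v} {V : Type w} [CommRing k] [Group N] [AddCommGroup V]
    [Module k V] (K : Type u) [CommRing K] [Algebra k K] (ρ : Representation k N V) :
    Representation K N (K ⊗[k] V) :=
  (Module.End.baseChangeHom k K V : Module.End k V →* Module.End K (K ⊗[k] V)).comp ρ

/-- A representation over a field `k` is absolutely simple if it is simple after extension of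
scalars to every field extension of `k`. -/
def IsAbsolutelySimple {k : Type u} {N : Type v} {V : Type w} [Field k] [Group N]
    [AddCommGroup V] [Module k V] (ρ : Representation k N V) : Prop :=
  ∀ (K : Type u) [Field K] [Algebra k K], (baseChangeRep K ρ).IsIrreducible

variable (ℓ : ℕ) [Fact ℓ.Prime]

/-- The quotient `S/ℓS`. -/
abbrev Reduction (S : Type w) [AddCommGroup S] [Module ℤ_[ℓ] S] : Type w :=
  S ⧸ LinearMap.range (LinearMap.lsmul ℤ_[ℓ] S (ℓ : ℤ_[ℓ]))

instance reductionModule (S : Type w) [AddCommGroup S] [Module ℤ_[ℓ] S] :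
    Module (ZMod ℓ) (Reduction ℓ S) :=
  AddCommGroup.zmodModule (n := ℓ) (by
    intro x
    obtain ⟨x, rfl⟩ := Submodule.Quotient.mk_surjective _ x
    rw [← Submodule.Quotient.mk_smul, Submodule.Quotient.mk_eq_zero]
    exact ⟨x, by simp [Nat.cast_smul_eq_nsmul]⟩)

/-- The action of `N` on `S/ℓS` induced by a `ℤ_ℓ`-linear action of `N` on `S`. -/
def reductionRep {N : Type v} {S : Type w} [Group N] [AddCommGroup S] [Module ℤ_[ℓ] S]
    (ρ : Representation ℤ_[ℓ] N S) : Representation (ZMod ℓ) N (Reduction ℓ S) where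
  toFun g := AddMonoidHom.toZModLinearMap ℓ
    (Submodule.mapQ (LinearMap.range (LinearMap.lsmul ℤ_[ℓ] S (ℓ : ℤ_[ℓ])))
      (LinearMap.range (LinearMap.lsmul ℤ_[ℓ] S (ℓ : ℤ_[ℓ]))) (ρ g) (by
        rintro _ ⟨x, rfl⟩
        exact ⟨ρ g x, by simp⟩)).toAddMonoidHom
  map_one' := by
    refine LinearMap.ext fun x => ?_
    obtain ⟨x, rfl⟩ := Submodule.Quotient.mk_surjective _ x
    simp
  map_mul' g h := by
    refine LinearMap.ext fun x => ?_
    obtain ⟨x, rfl⟩ := Submodule.Quotient.mk_surjective _ x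
    simp

/-- The natural homomorphism `ℤ_ℓ[N] → End_{ℚ_ℓ}(W)`, where `W = S ⊗ ℚ_ℓ`. -/
def groupRingToEnd {N : Type v} {S : Type w} [Group N] [AddCommGroup S] [Module ℤ_[ℓ] S]
    (ρ : Representation ℤ_[ℓ] N S) :
    MonoidAlgebra ℤ_[ℓ] N →ₐ[ℤ_[ℓ]] Module.End ℚ_[ℓ] (ℚ_[ℓ] ⊗[ℤ_[ℓ]] S) :=
  (Module.End.baseChangeHom ℤ_[ℓ] ℚ_[ℓ] S).comp ρ.asAlgebraHom

/-- A `ℤ_ℓ[N]`-module `S` is well-rounded if it is free of finite rank `m` over `ℤ_ℓ` and satisfies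
the following conditions, which are equivalent to each other for such `S`:
`ℤ_ℓ[N] → End(S)` is surjective; `S/ℓS` is absolutely simple; the image of
`ℤ_ℓ[N] → End(S ⊗ ℚ_ℓ)` is isomorphic to `M_m(ℤ_ℓ)`. -/
structure IsWellRounded {N : Type v} {S : Type w} [Group N] [AddCommGroup S] [Module ℤ_[ℓ] S]
    (ρ : Representation ℤ_[ℓ] N S) : Prop where
  free : Module.Free ℤ_[ℓ] S
  finite : Module.Finite ℤ_[ℓ] S
  surjective : Function.Surjective ρ.asAlgebraHom
  absolutelySimple : IsAbsolutelySimple (reductionRep ℓ ρ)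
  image_equiv_matrix : Nonempty ((groupRingToEnd ℓ ρ).range ≃ₐ[ℤ_[ℓ]]
    Matrix (Fin (Module.finrank ℤ_[ℓ] S)) (Fin (Module.finrank ℤ_[ℓ] S)) ℤ_[ℓ])

/-! ### Torsion and Tate modules of an abelian group with a group action -/

section TateModule

variable {A : Type u} [AddCommGroup A]

instance torsionModule (n : ℕ) : Module (ZMod n) (AddSubgroup.torsionBy A (n : ℤ)) :=
  AddSubgroup.torsionBy.zmodModule

variable (A) in
/-- The inverse limit of the groups `A[ℓ^n]` along multiplication by `ℓ`, as a group of
sequences. -/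
def TateModule : AddSubgroup (ℕ → A) where
  carrier := {f | ∀ n, ℓ ^ n • f n = 0 ∧ ℓ • f (n + 1) = f n}
  zero_mem' := by simp
  add_mem' := by
    intro f g hf hg n
    simp [smul_add, hf n, hg n]
  neg_mem' := by
    intro f hf n
    simp [smul_neg, hf n]

lemma nsmul_congr {a : A} {N k m : ℕ} (ha : N • a = 0) (h : (k : ZMod N) = (m : ZMod N)) :
    k • a = m • a := by
  rw [ZMod.natCast_eq_natCast_iff'] at h
  rw [← Nat.mod_add_div k N, ← Nat.mod_add_div m N, add_smul, add_smul, mul_comm N, mul_comm N,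
    mul_smul, mul_smul, ha, h]
  simp

instance (n : ℕ) : NeZero (ℓ ^ n) := ⟨pow_ne_zero n (Fact.out : ℓ.Prime).ne_zero⟩

/-- `z ∈ ℤ_ℓ` acts on the `n`-th component through its image in `ℤ/ℓ^n`. -/
instance : SMul ℤ_[ℓ] (TateModule ℓ A) where
  smul z f := ⟨fun n => (PadicInt.toZModPow n z).val • f.1 n, fun n => ⟨by
    rw [smul_comm, (f.2 n).1, smul_zero], by
    rw [smul_comm, (f.2 n).2]
    refine nsmul_congr (f.2 n).1 ?_
    rw [ZMod.natCast_val, PadicInt.cast_toZModPow n (n + 1) n.le_succ, ZMod.natCast_val,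
      ZMod.cast_id]⟩⟩

lemma TateModule.smul_apply (z : ℤ_[ℓ]) (f : TateModule ℓ A) (n : ℕ) :
    (z • f).1 n = (PadicInt.toZModPow n z).val • f.1 n := rfl

instance : Module ℤ_[ℓ] (TateModule ℓ A) where
  one_smul f := by
    ext n
    rw [TateModule.smul_apply, ← one_smul ℕ (f.1 n), smul_smul, mul_one]
    exact nsmul_congr (f.2 n).1 (by simp)
  mul_smul x y f := by
    ext n
    simp only [TateModule.smul_apply, smul_smul]
    exact nsmul_congr (f.2 n).1 (by simp)
  smul_zero x := by
    ext n
    simp [TateModule.smul_apply]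
  smul_add x f g := by
    ext n
    simp [TateModule.smul_apply]
  add_smul x y f := by
    ext n
    simp only [TateModule.smul_apply, AddSubgroup.coe_add, Pi.add_apply, ← add_smul]
    exact nsmul_congr (f.2 n).1 (by simp)
  zero_smul f := by
    ext n
    simp [TateModule.smul_apply]

variable {G : Type v} [Group G]

/-- The action of `G` on the `n`-torsion `A[n]`. -/
def torsionRep (n : ℕ) (φ : G →* AddMonoid.End A) :
    Representation (ZMod n) G (AddSubgroup.torsionBy A (n : ℤ)) where
  toFun g := AddMonoidHom.toZModLinearMap n
    { toFun := fun x => ⟨φ g x.1, by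
        rw [AddSubgroup.torsionBy.nsmul_iff, ← map_nsmul,
          AddSubgroup.torsionBy.nsmul_iff.mp x.2, map_zero]⟩
      map_zero' := by ext; simp
      map_add' := fun x y => by ext; simp }
  map_one' := by ext x; simp
  map_mul' g h := by ext x; simp

/-- The action of `G` on the Tate module of `A`. -/
def tateRep (φ : G →* AddMonoid.End A) : Representation ℤ_[ℓ] G (TateModule ℓ A) where
  toFun g :=
    { toFun := fun f => ⟨fun n => φ g (f.1 n), fun n => by
        rw [← map_nsmul, ← map_nsmul, (f.2 n).1, (f.2 n).2, map_zero]; exact ⟨rfl, rfl⟩⟩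
      map_add' := fun f f' => by ext n; simp
      map_smul' := fun z f => by ext n; simp [TateModule.smul_apply] }
  map_one' := by ext f n; simp
  map_mul' g h := by ext f n; simp

end TateModule

/-! ### Galois representations of an elliptic curve -/

section Elliptic

variable (F : Type u) [Field F]

instance : DecidableEq (SeparableClosure F) := Classical.decEq _

/-- The absolute Galois group `G_F = Gal(F^s/F)`. -/
abbrev AbsGal : Type u := SeparableClosure F ≃ₐ[F] SeparableClosure F

/-- The field `F(μ_{ℓ^∞})` inside `F^s`. -/
def cyclotomicTower : IntermediateField F (SeparableClosure F) :=
  IntermediateField.adjoin F {ζ | ∃ n : ℕ, ζ ^ ℓ ^ n = 1}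

/-- The absolute Galois group of `F(μ_{ℓ^∞})`, as a subgroup of `G_F`. -/
def cyclotomicGal : Subgroup (AbsGal F) := (cyclotomicTower ℓ F).fixingSubgroup

variable {F}

/-- The group `E(F^s)`. -/
abbrev GeomPoint (E : WeierstrassCurve F) : Type u :=
  (E.baseChange (SeparableClosure F)).toAffine.Point

/-- The action of `G_F` on `E(F^s)`. -/
def galAction (E : WeierstrassCurve F) : AbsGal F →* AddMonoid.End (GeomPoint E) where
  toFun σ := WeierstrassCurve.Affine.Point.map (W' := E.toAffine) (σ : _ →ₐ[F] _)
  map_one' := by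
    ext P
    exact WeierstrassCurve.Affine.Point.map_id (W' := E.toAffine) P
  map_mul' σ τ := by
    ext P
    exact (WeierstrassCurve.Affine.Point.map_map (W' := E.toAffine)
      (τ : SeparableClosure F →ₐ[F] SeparableClosure F)
      (σ : SeparableClosure F →ₐ[F] SeparableClosure F) P).symm

/-- The `n`-torsion `E_n` of `E(F^s)`. -/
abbrev Torsion (E : WeierstrassCurve F) (n : ℕ) : Type u :=
  AddSubgroup.torsionBy (GeomPoint E) (n : ℤ)

/-- The mod `n` representation `ρ_{E,n}` of `G_F` on `E_n`. -/
def modRep (E : WeierstrassCurve F) (n : ℕ) : Representation (ZMod n) (AbsGal F) (Torsion E n) :=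
  torsionRep n (galAction E)

/-- The `ℓ`-adic representation of `G_F` on `T_ℓ(E)`. -/
def ladicRep (E : WeierstrassCurve F) :
    Representation ℤ_[ℓ] (AbsGal F) (TateModule ℓ (GeomPoint E)) :=
  tateRep ℓ (galAction E)

/-- `E` is `ℓ`-full if `T_ℓ(E)` is a well-rounded module over the group ring of the absolute Galois
group of `F(μ_{ℓ^∞})`. -/
def IsFull (E : WeierstrassCurve F) : Prop :=
  IsWellRounded ℓ ((ladicRep ℓ E).comp (cyclotomicGal ℓ F).subtype)

/-- The image of `ρ_{E,ℓ}` contains the automorphisms of determinant one of the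
`𝔽_ℓ`-vector space `E_ℓ`. -/
def ImageContainsSL (E : WeierstrassCurve F) : Prop :=
  ∀ g : SpecialLinearGroup (ZMod ℓ) (Torsion E ℓ), ∃ σ : AbsGal F,
    modRep E ℓ σ = (g.1 : Torsion E ℓ →ₗ[ZMod ℓ] Torsion E ℓ)

end Elliptic

end EllFull

end

/-! The field generated by `ℓ`-power roots of unity is abelian over `F`, so `N = G_{F^{(ℓ)}}`
contains every commutator of `G_F` (`commutator_le_cyclotomicGal`). The image of `ρ_{E,ℓ}` contains
all transvections, since they have determinant one. If `τ` acts as a transvection `1 + n` and `b` is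
the image of a suitable commutator, then `τbτ⁻¹ + τ⁻¹bτ - 2b = -2nbn = 2n`. The left side lies in
the image of `𝔽_ℓ[N]` and `2` is invertible, so this image contains `n`, then all rank one maps,
then all of `End(E_ℓ)` (`asAlgebraHom_surjective_of_commutator_le`). No perfectness of `SL₂` is
needed, so `ℓ = 3` is not special.

Surjectivity onto `End(E_ℓ)` gives absolute simplicity, and Nakayama lifts it to `T_ℓ(E)`, provided
that `T_ℓ(E)` is free of finite rank and reduces to `E_ℓ`. For this it suffices that `E(F^s)` is
`ℓ`-divisible with finite `ℓ`-torsion; `E_ℓ` must also be nonzero. That its dimension is two is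
never used.

These facts about `E(F^s)` come from writing `x(nP)` as a quotient `f/g` of coprime polynomials in
`x(P)`, with `f` monic of degree `n²` (`exists_isMulX`). When `n` is nonzero in the field, the
Wronskian of `f` and `g` does not vanish, so `f - a g` has `n²` distinct roots for almost all `a`
(`IsMulX.exists_fibre`). Divisibility and torsion are read off from these fibres. -/

noncomputable section

namespace WeierstrassCurve

open Polynomial

/-! ### The `x`-coordinates of `P + Q` and `P - Q` -/

section AddSub

variable {L : Type*} [Field L] {W : WeierstrassCurve L}

/-- The three forms of `addSubMap` have no common zero `(s, t, u) ≠ 0`. -/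
lemma addSubMap_vec_ne_zero [W.IsElliptic] {s t u : L}
    (h₁ : s ^ 2 - W.b₄ * s * u - W.b₆ * t * u - W.b₈ * u ^ 2 = 0)
    (h₂ : 2 * t * s + W.b₂ * s * u + W.b₄ * t * u + W.b₆ * u ^ 2 = 0)
    (h₃ : t ^ 2 - 4 * s * u = 0) : s = 0 ∧ t = 0 ∧ u = 0 := by
  by_contra hne
  have hv : (![s, t, u] : Fin 3 → L) ≠ 0 := by
    intro h
    exact hne ⟨congrFun h 0, congrFun h 1, congrFun h 2⟩
  refine addSubMap_ne_zero W hv ?_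
  ext i
  fin_cases i
  · simpa [addSubMap] using h₁
  · simpa [addSubMap] using h₂
  · simpa [addSubMap] using h₃

/-- Addition and subtraction on `x`-coordinates, for points with different `x`-coordinates. -/
lemma addX_mul_sub_sq [DecidableEq L] {x₁ y₁ x₂ y₂ : L} (h₁ : W.toAffine.Equation x₁ y₁)
    (h₂ : W.toAffine.Equation x₂ y₂) (hx : x₁ ≠ x₂) :
    let a := W.toAffine.addX x₁ x₂ (W.toAffine.slope x₁ x₂ y₁ y₂)
    let b := W.toAffine.addX x₁ x₂ (W.toAffine.slope x₁ x₂ y₁ (W.toAffine.negY x₂ y₂))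
    let s := x₁ * x₂
    let t := x₁ + x₂
    (x₁ - x₂) ^ 2 * (a * b) = s ^ 2 - W.b₄ * s - W.b₆ * t - W.b₈ ∧
    (x₁ - x₂) ^ 2 * (a + b) = 2 * t * s + W.b₂ * s + W.b₄ * t + W.b₆ := by
  intro a b s t
  have hx' : x₁ - x₂ ≠ 0 := sub_ne_zero.mpr hx
  rw [Affine.equation_iff] at h₁ h₂
  have ha : a = ((y₁ - y₂) ^ 2 + W.a₁ * (y₁ - y₂) * (x₁ - x₂)
      - (W.a₂ + x₁ + x₂) * (x₁ - x₂) ^ 2) / (x₁ - x₂) ^ 2 := by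
    simp only [a, Affine.addX, Affine.slope_of_X_ne hx]
    field_simp
    ring
  have hb : b = ((y₁ + y₂ + W.a₁ * x₂ + W.a₃) ^ 2
      + W.a₁ * (y₁ + y₂ + W.a₁ * x₂ + W.a₃) * (x₁ - x₂)
      - (W.a₂ + x₁ + x₂) * (x₁ - x₂) ^ 2) / (x₁ - x₂) ^ 2 := by
    simp only [b, Affine.addX, Affine.slope_of_X_ne hx, Affine.negY]
    field_simp
    ring
  set R₁ := x₁ ^ 3 + W.a₂ * x₁ ^ 2 + W.a₄ * x₁ + W.a₆ with hR₁
  set R₂ := x₂ ^ 3 + W.a₂ * x₂ ^ 2 + W.a₄ * x₂ + W.a₆ with hR₂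
  set n₁ := W.a₁ * x₁ + W.a₃ with hn₁
  set n₂ := W.a₁ * x₂ + W.a₃ with hn₂
  set S := R₁ + R₂ - (W.a₂ + x₁ + x₂) * (x₁ - x₂) ^ 2 with hS
  have e₁ : y₁ * (y₁ + n₁) = R₁ := by rw [hn₁]; linear_combination h₁
  have e₂ : y₂ * (y₂ + n₂) = R₂ := by rw [hn₂]; linear_combination h₂
  -- `hA` and `hB` differ by exchanging `y₂` with its conjugate `-y₂ - n₂`, so the sum and product
  -- of the right sides involve only the `x`-coordinates once `e₁` and `e₂` are used.
  have hA : (x₁ - x₂) ^ 2 * a = S - n₂ * y₁ - (2 * y₁ + n₁) * y₂ := by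
    rw [ha, mul_div_cancel₀ _ (pow_ne_zero 2 hx'), hS, ← e₁, ← e₂, hn₁, hn₂]
    ring
  have hB : (x₁ - x₂) ^ 2 * b = S - n₂ * y₁ + (2 * y₁ + n₁) * (y₂ + n₂) := by
    rw [hb, mul_div_cancel₀ _ (pow_ne_zero 2 hx'), hS, ← e₁, ← e₂, hn₁, hn₂]
    ring
  constructor
  · refine mul_left_cancel₀ (pow_ne_zero 2 hx') ?_
    have key : ((x₁ - x₂) ^ 2 * a) * ((x₁ - x₂) ^ 2 * b) =
        S ^ 2 + S * n₁ * n₂ - n₂ ^ 2 * R₁ - n₁ ^ 2 * R₂ - 4 * R₁ * R₂ := by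
      rw [hA, hB]
      linear_combination (-n₂ ^ 2 - 4 * R₂) * e₁ - (2 * y₁ + n₁) ^ 2 * e₂
    calc _ = ((x₁ - x₂) ^ 2 * a) * ((x₁ - x₂) ^ 2 * b) := by ring
      _ = _ := key
      _ = _ := by
        simp only [hS, hR₁, hR₂, hn₁, hn₂, s, t, b₄, b₆, b₈]
        ring
  · rw [mul_add, hA, hB]
    simp only [hS, hR₁, hR₂, hn₁, hn₂, s, t, b₂, b₄, b₆]
    ring

/-- The form `4x³ + b₂x² + 2b₄x + b₆` whose roots are the `x`-coordinates of order two. -/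
lemma sq_sub_negY {x y : L} (h : W.toAffine.Equation x y) :
    (y - W.toAffine.negY x y) ^ 2 = 4 * x ^ 3 + W.b₂ * x ^ 2 + 2 * W.b₄ * x + W.b₆ := by
  rw [Affine.equation_iff] at h
  simp only [Affine.negY, b₂, b₄, b₆]
  linear_combination 4 * h

/-- The tangent slope has denominator `y - negY x y`, and its square is the cubic of `sq_sub_negY`;
clearing it gives the duplication formula. -/
lemma addX_self_mul [DecidableEq L] {x y : L} (h : W.toAffine.Equation x y) (hy : y ≠ W.toAffine.negY x y) :
    (4 * x ^ 3 + W.b₂ * x ^ 2 + 2 * W.b₄ * x + W.b₆) *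
      W.toAffine.addX x x (W.toAffine.slope x x y y) =
    x ^ 4 - W.b₄ * x ^ 2 - 2 * W.b₆ * x - W.b₈ := by
  have hy' : y - W.toAffine.negY x y ≠ 0 := sub_ne_zero.mpr hy
  rw [← sq_sub_negY h]
  have e := h
  rw [Affine.equation_iff] at e
  set η := y - W.toAffine.negY x y with hη
  rw [Affine.addX, Affine.slope_of_Y_ne rfl hy, ← hη]
  have hη' : η = 2 * y + W.a₁ * x + W.a₃ := by rw [hη, Affine.negY]; ring
  have hX (M : L) : η ^ 2 * ((M / η) ^ 2 + W.a₁ * (M / η) - W.a₂ - x - x) =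
      M ^ 2 + W.a₁ * M * η - (W.a₂ + 2 * x) * η ^ 2 := by
    field_simp
    ring
  rw [hX, hη']
  simp only [b₄, b₆, b₈]
  linear_combination (-W.a₁ ^ 2 - 4 * W.a₂ - 8 * x) * e

open Affine.Point in
/-- Addition and subtraction on `x`-coordinates. -/
lemma addSubMap_sym2x [DecidableEq L] [W.IsElliptic] (P Q : W.toAffine.Point) : ∃ c : L, c ≠ 0 ∧
    ∀ i, (addSubMap W i).eval (sym2x P Q) = c * sym2x (P + Q) (P - Q) i := by
  -- The diagonal case `P = Q`. It also settles `P = -Q`, because negating a point does not change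
  -- its `x`-coordinate.
  have self (x y : L) (h : W.toAffine.Nonsingular x y) : ∃ c : L, c ≠ 0 ∧
      ∀ i, (addSubMap W i).eval (sym2x (some x y h) (some x y h)) =
        c * sym2x (some x y h + some x y h) 0 i := by
    by_cases hy : y = W.toAffine.negY x y
    · have h0 := sq_sub_negY h.1
      rw [sub_eq_zero.mpr hy, zero_pow two_ne_zero] at h0
      -- At a point of order two the other two forms vanish, so the scalar is the value of the first
      -- form; it is nonzero as the forms have no common zero.
      refine ⟨x ^ 4 - W.b₄ * x ^ 2 - 2 * W.b₆ * x - W.b₈, fun hc => ?_, fun i => ?_⟩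
      · exact one_ne_zero (addSubMap_vec_ne_zero (W := W) (s := x * x) (t := x + x) (u := (1 : L))
          (by linear_combination hc) (by linear_combination -h0) (by ring)).2.2
      · rw [add_self_of_Y_eq hy, sym2x_zero_zero, sym2x_some_some]
        fin_cases i
        · simp [addSubMap]; ring
        · simp [addSubMap]; linear_combination -h0
        · simp [addSubMap]; ring
    · have hne : 4 * x ^ 3 + W.b₂ * x ^ 2 + 2 * W.b₄ * x + W.b₆ ≠ 0 := by
        rw [← sq_sub_negY h.1]
        exact pow_ne_zero 2 (sub_ne_zero.mpr hy)
      have key := addX_self_mul h.1 hy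
      refine ⟨_, hne, fun i => ?_⟩
      rw [add_self_of_Y_ne hy, sym2x_some_zero, sym2x_some_some]
      generalize W.toAffine.addX x x _ = z at key ⊢
      fin_cases i
      · simp [addSubMap]; linear_combination -key
      · simp [addSubMap]; ring
      · simp [addSubMap]; ring
  rcases P with _ | ⟨x₁, y₁, h₁⟩ <;> rcases Q with _ | ⟨x₂, y₂, h₂⟩
  · refine ⟨1, one_ne_zero, fun i => ?_⟩
    rw [← zero_def, add_zero, sub_zero, sym2x_zero_zero]
    fin_cases i <;> simp [addSubMap]
  · refine ⟨1, one_ne_zero, fun i => ?_⟩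
    rw [← zero_def, zero_add, zero_sub, sym2x_neg_right, sym2x_zero_some, sym2x_some_some]
    fin_cases i <;> simp [addSubMap] <;> ring
  · refine ⟨1, one_ne_zero, fun i => ?_⟩
    rw [← zero_def, add_zero, sub_zero, sym2x_some_zero, sym2x_some_some]
    fin_cases i <;> simp [addSubMap] <;> ring
  · by_cases hx : x₁ = x₂
    · rcases X_eq_iff.mp hx with h | h
      · rw [h, sub_self]
        exact self ..
      · rw [h, neg_add_cancel, sym2x_neg_left, sym2x_comm 0, ← neg_add', sym2x_neg_left]
        exact self ..
    · have hx' := sub_ne_zero.mpr hx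
      obtain ⟨k₁, k₂⟩ := addX_mul_sub_sq h₁.1 h₂.1 hx
      refine ⟨(x₁ - x₂) ^ 2, pow_ne_zero 2 hx', fun i => ?_⟩
      rw [sub_eq_add_neg (some x₁ y₁ h₁), neg_some, add_of_X_ne hx, add_of_X_ne hx,
        sym2x_some_some, sym2x_some_some]
      generalize W.toAffine.addX x₁ x₂ _ = z at k₁ k₂ ⊢
      generalize W.toAffine.addX x₁ x₂ _ = z' at k₁ k₂ ⊢
      fin_cases i
      · simp [addSubMap]; linear_combination -k₁
      · simp [addSubMap]; linear_combination -k₂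
      · simp [addSubMap]; ring

end AddSub
end WeierstrassCurve

/-! ### Points over a separably closed field -/

lemma IsSepClosed.infinite (k : Type*) [Field k] [IsSepClosed k] : Infinite k := by
  by_contra h
  rw [not_infinite_iff_finite] at h
  exact not_finite_iff_infinite.mpr (inferInstance : Infinite k) h

namespace WeierstrassCurve

open Polynomial

section Points

variable {k : Type*} [Field k] (W : WeierstrassCurve k)

lemma eval_Ψ₂Sq (x : k) :
    W.Ψ₂Sq.eval x = 4 * x ^ 3 + W.b₂ * x ^ 2 + 2 * W.b₄ * x + W.b₆ := by
  simp [Ψ₂Sq]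

/-- Vanishing would force characteristic two and `b₂ = b₆ = 0`, leaving `Δ = -8 b₄³ = 0`. -/
lemma Ψ₂Sq_ne_zero_of_isElliptic [W.IsElliptic] : W.Ψ₂Sq ≠ 0 := by
  intro h
  have h3 : (4 : k) = 0 := by rw [← W.coeff_Ψ₂Sq, h, coeff_zero]
  have h2 : W.b₂ = 0 := by
    have := congrArg (coeff · 2) h
    simpa [Ψ₂Sq, coeff_X, coeff_C] using this
  have h0 : W.b₆ = 0 := by
    have := congrArg (coeff · 0) h
    simpa [Ψ₂Sq, coeff_X, coeff_C] using this
  have h2' : (2 : k) = 0 := by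
    have : (2 : k) * 2 = 0 := by rw [← h3]; norm_num
    simpa using this
  refine W.isUnit_Δ.ne_zero ?_
  rw [Δ, h2, h0]
  linear_combination (-4 * W.b₄ ^ 3) * h2'

/-- The Weierstrass equation is quadratic in `y` with discriminant `Ψ₂Sq(x)`, so it is separable
here, in characteristic two as well. -/
lemma exists_nonsingular_of_eval_Ψ₂Sq_ne_zero [IsSepClosed k] [W.IsElliptic] {x : k}
    (hx : W.Ψ₂Sq.eval x ≠ 0) : ∃ y, W.toAffine.Nonsingular x y := by
  set n := W.a₁ * x + W.a₃ with hn
  set r := x ^ 3 + W.a₂ * x ^ 2 + W.a₄ * x + W.a₆ with hr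
  set p : k[X] := X ^ 2 + C n * X + C (-r) with hp
  have hdeg : p.degree = 2 := by
    rw [hp]; compute_degree!
  have hδ : W.Ψ₂Sq.eval x = n ^ 2 + 4 * r := by
    rw [eval_Ψ₂Sq, hn, hr, b₂, b₄, b₆]; ring
  have hsep : p.Separable := by
    -- The Bézout coefficients come from `(2X + n)² - 4p = n² + 4r`.
    refine ⟨C (-4 / W.Ψ₂Sq.eval x), C (1 / W.Ψ₂Sq.eval x) * (2 * X + C n), ?_⟩
    have hd : derivative p = 2 * X + C n := by simp [hp]; norm_num
    have h1 : C (1 / W.Ψ₂Sq.eval x) * C (n ^ 2 + 4 * r) = 1 := by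
      rw [← C_mul, ← hδ, one_div, inv_mul_cancel₀ hx, C_1]
    have h4 : C (-4 / W.Ψ₂Sq.eval x) = -4 * C (1 / W.Ψ₂Sq.eval x) := by
      rw [show (-4 / W.Ψ₂Sq.eval x) = -4 * (1 / W.Ψ₂Sq.eval x) by ring, C_mul, C_neg]
      rw [show (C (4 : k) : k[X]) = 4 from map_ofNat C 4]
    have hn4 : C (n ^ 2 + 4 * r) = C n ^ 2 + 4 * C r := by
      rw [C_add, C_mul, C_pow, show (C (4 : k) : k[X]) = 4 from map_ofNat C 4]
    rw [hd, ← h1, h4, hn4, hp, C_neg]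
    ring
  obtain ⟨y, hy⟩ := IsSepClosed.exists_root p (by rw [hdeg]; decide) hsep
  refine ⟨y, Affine.equation_iff_nonsingular.mp ?_⟩
  rw [Affine.equation_iff]
  simp only [hp, IsRoot.def, eval_add, eval_mul, eval_pow, eval_X, eval_C] at hy
  rw [hn, hr] at hy
  linear_combination hy

/-- The points whose `x`-coordinate is a root of a given nonzero polynomial are finite in number. -/
lemma finite_points_of_root {p : k[X]} (hp : p ≠ 0) :
    {P : W.toAffine.Point | ∀ x y h, P = .some x y h → p.eval x = 0}.Finite := by
  classical
  have hfin : {q : k × k | W.toAffine.Equation q.1 q.2 ∧ p.eval q.1 = 0}.Finite := by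
    have hr := p.roots.toFinset.finite_toSet
    refine Set.Finite.subset (hr.biUnion (t := fun x => (fun y => (x, y)) ''
      {y | (X ^ 2 + C (W.a₁ * x + W.a₃) * X
        + C (-(x ^ 3 + W.a₂ * x ^ 2 + W.a₄ * x + W.a₆)) : k[X]).IsRoot y})
      fun x _ => Set.Finite.image _ (Polynomial.finite_setOfPred_isRoot ?_)) ?_
    · apply Monic.ne_zero; monicity!
    · rintro ⟨x, y⟩ ⟨h, hx⟩
      rw [Affine.equation_iff] at h
      simp only [Set.mem_iUnion]
      refine ⟨x, by simpa [hp] using hx, y, ?_, rfl⟩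
      simp only [Set.mem_ofPred_eq, IsRoot.def, eval_add, eval_mul, eval_pow, eval_X, eval_C]
      linear_combination h
  refine ((hfin.image fun q => if h : W.toAffine.Nonsingular q.1 q.2 then
    Affine.Point.some q.1 q.2 h else 0).union (Set.finite_singleton 0)).subset ?_
  rintro (_ | ⟨x, y, h⟩) hP
  · exact Or.inr rfl
  · exact Or.inl ⟨(x, y), ⟨h.1, hP x y h rfl⟩, by simp [h]⟩

end Points
end WeierstrassCurve

namespace WeierstrassCurve

open Polynomial

/-! ### Multiplication by `n` on `x`-coordinates -/

section Mul

variable {k : Type*} [Field k]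

/-- Factorisation of a binary quadratic form with a given primitive linear factor. -/
lemma exists_factor_of_root {f g s t u : k[X]} (hfg : IsCoprime f g) (hf : f ≠ 0)
    (h : u * f ^ 2 - t * f * g + s * g ^ 2 = 0) :
    ∃ f' g' : k[X], f * f' = s ∧ f * g' + f' * g = t ∧ g * g' = u := by
  rcases eq_or_ne g 0 with rfl | hg
  · obtain ⟨r, hr⟩ := isCoprime_zero_right.mp hfg |>.exists_right_inv
    refine ⟨r * s, r * t, ?_, ?_, ?_⟩
    · linear_combination s * hr
    · linear_combination t * hr
    · have : u * f ^ 2 = 0 := by linear_combination h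
      rcases mul_eq_zero.mp this with h | h
      · rw [h, zero_mul]
      · exact absurd (pow_eq_zero_iff two_ne_zero |>.mp h) hf
  · have h1 : g ∣ f ^ 2 * u := ⟨t * f - s * g, by linear_combination h⟩
    obtain ⟨g', rfl⟩ := (hfg.symm.pow_right).dvd_of_dvd_mul_left h1
    have h2 : g' * f ^ 2 - t * f + s * g = 0 := by
      refine mul_left_cancel₀ hg ?_
      linear_combination h
    have h3 : f ∣ g * s := ⟨t - g' * f, by linear_combination h2⟩
    obtain ⟨f', rfl⟩ := hfg.dvd_of_dvd_mul_left h3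
    refine ⟨f', g', rfl, ?_, rfl⟩
    refine mul_left_cancel₀ hf ?_
    linear_combination h2

variable (W : WeierstrassCurve k)

/-- The first form of `addSubMap` at `(f X, f + X g, g)`. -/
def dupS (f g : k[X]) : k[X] := (f * X) ^ 2 - C W.b₄ * (f * X) * g - C W.b₆ * (f + X * g) * g
  - C W.b₈ * g ^ 2

/-- The second form of `addSubMap` at `(f X, f + X g, g)`. -/
def dupT (f g : k[X]) : k[X] := 2 * (f + X * g) * (f * X) + C W.b₂ * (f * X) * g
  + C W.b₄ * (f + X * g) * g + C W.b₆ * g ^ 2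

/-- The third form of `addSubMap` at `(f X, f + X g, g)`. -/
def dupU (f g : k[X]) : k[X] := (f + X * g) ^ 2 - 4 * (f * X) * g

/-- Modulo a common irreducible factor of `f'` and `g'` all three forms vanish over the field
`k[X]/(q)`. The curve stays elliptic there, so `f` and `g` vanish too, against their coprimality. -/
lemma isCoprime_of_dup [W.IsElliptic] {f g f₀ g₀ f' g' : k[X]} (hfg : IsCoprime f g)
    (hs : f₀ * f' = W.dupS f g) (ht : f₀ * g' + f' * g₀ = W.dupT f g)
    (hu : g₀ * g' = dupU f g) : IsCoprime f' g' := by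
  suffices ∀ q, Irreducible q → q ∣ f' → q ∣ g' → False from
    isCoprime_of_irreducible_dvd (fun h => this X irreducible_X (h.1 ▸ dvd_zero X)
      (h.2 ▸ dvd_zero X)) this
  intro q hq hqf hqg
  have := Fact.mk hq
  let φ := AdjoinRoot.mk q
  have hf' : φ f' = 0 := AdjoinRoot.mk_eq_zero.mpr hqf
  have hg' : φ g' = 0 := AdjoinRoot.mk_eq_zero.mpr hqg
  replace hs := congrArg φ hs
  replace ht := congrArg φ ht
  replace hu := congrArg φ hu
  simp only [dupS, dupT, dupU, map_add, map_sub, map_mul, map_pow, hf', hg', mul_zero, zero_mul,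
    add_zero, map_ofNat] at hs ht hu
  obtain ⟨-, h2, h3⟩ := addSubMap_vec_ne_zero (W := W.map (φ.comp C)) (s := φ f * φ X)
    (t := φ f + φ X * φ g) (u := φ g) (by simpa using hs.symm) (by simpa using ht.symm) hu.symm
  obtain ⟨a, b, hab⟩ := hfg
  have := congrArg φ hab
  rw [h3, mul_zero, add_zero] at h2
  simp [h2, h3] at this

/-- Tracking `X * g` instead of `g` avoids a degree `n - 1` and allows `n = 0`, where `g = 0`. -/
lemma natDegree_dupS_dupT {f g : k[X]} {n : ℕ} (hf : f.natDegree ≤ n) (hf' : f.coeff n = 1)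
    (hg : (X * g).natDegree ≤ n) :
    (W.dupS f g).natDegree ≤ 2 * n + 2 ∧ (W.dupS f g).coeff (2 * n + 2) = 1 ∧
    (X * W.dupT f g).natDegree ≤ 2 * n + 2 ∧
      (X * W.dupT f g).coeff (2 * n + 2) = 2 * (1 + (X * g).coeff n) := by
  have hg' : g.natDegree ≤ n := by
    rcases eq_or_ne g 0 with rfl | h
    · simp
    · rw [natDegree_X_mul h] at hg
      omega
  set G := X * g with hG
  have hfG : (f + G).natDegree ≤ n := natDegree_add_le_of_degree_le hf hg
  have hC (a : k) {p q : k[X]} (hp : p.natDegree ≤ n) (hq : q.natDegree ≤ n) :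
      (C a * (p * q)).natDegree ≤ 2 * n := by
    refine (natDegree_C_mul_le _ _).trans ?_
    rw [two_mul]
    exact natDegree_mul_le_of_le hp hq
  have main {p : k[X]} (hp : p.natDegree ≤ n) : (p * f * X ^ 2).natDegree ≤ 2 * n + 2 ∧
      (p * f * X ^ 2).coeff (2 * n + 2) = p.coeff n := by
    refine ⟨(natDegree_mul_le_of_le (natDegree_mul_le_of_le hp hf)
      (natDegree_X_pow_le 2)).trans (by omega), ?_⟩
    rw [coeff_mul_X_pow, two_mul, coeff_mul_add_eq_of_natDegree_le hp hf, hf', mul_one]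
  have hsum {p q : k[X]} {c : k} (hp : p.natDegree ≤ 2 * n + 2 ∧ p.coeff (2 * n + 2) = c)
      (hq : q.natDegree ≤ 2 * n + 1) :
      (p + q).natDegree ≤ 2 * n + 2 ∧ (p + q).coeff (2 * n + 2) = c := by
    refine ⟨natDegree_add_le_of_degree_le hp.1 (hq.trans (by omega)), ?_⟩
    rw [coeff_add, hp.2, coeff_eq_zero_of_natDegree_lt (p := q) (by omega), add_zero]
  have hS : W.dupS f g = f * f * X ^ 2 +
      (C (-W.b₄) * (f * G) + C (-W.b₆) * ((f + G) * g) + C (-W.b₈) * (g * g)) := by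
    simp only [dupS, hG, C_neg]
    ring
  have hT : X * W.dupT f g = C 2 * ((f + G) * f * X ^ 2) +
      (C W.b₂ * (f * G) * X + C W.b₄ * ((f + G) * G) + C W.b₆ * (g * G)) := by
    simp only [dupT, hG, map_ofNat]
    ring
  rw [hS, hT]
  refine and_assoc.mp ⟨?_, ?_⟩
  · rw [← hf']
    refine hsum (main hf) (le_trans ?_ (Nat.le_succ _))
    exact natDegree_add_le_of_degree_le (natDegree_add_le_of_degree_le (hC _ hf hg)
      (hC _ hfG hg')) (hC _ hg' hg')
  · refine hsum ⟨(natDegree_C_mul_le _ _).trans (main hfG).1, ?_⟩ ?_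
    · rw [coeff_C_mul, (main hfG).2, coeff_add, hf']
    · refine natDegree_add_le_of_degree_le (natDegree_add_le_of_degree_le ?_ ?_) ?_
      · exact natDegree_mul_le_of_le (hC _ hf hg) natDegree_X_le
      · exact (hC _ hfG hg).trans (Nat.le_succ _)
      · exact (hC _ hg' hg).trans (Nat.le_succ _)

variable [DecidableEq k]

/-- `(f : g)` is a primitive representation of `x(nP)` as a rational function of `x(P)`. -/
structure IsMulX (n : ℕ) (f g : k[X]) : Prop where
  coprime : IsCoprime f g
  natDegree_le : f.natDegree ≤ n ^ 2
  coeff_eq : f.coeff (n ^ 2) = 1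
  natDegree_mul_le : (X * g).natDegree ≤ n ^ 2
  coeff_mul_eq : (X * g).coeff (n ^ 2) = (n : k) ^ 2
  xRep (x y : k) (h : W.toAffine.Nonsingular x y) : ∃ c : k, c ≠ 0 ∧
    f.eval x = c * (n • Affine.Point.some x y h).xRep 0 ∧
    g.eval x = c * (n • Affine.Point.some x y h).xRep 1

variable {W}

lemma IsMulX.zero : W.IsMulX 0 1 0 where
  coprime := isCoprime_one_left
  natDegree_le := by simp
  coeff_eq := by simp
  natDegree_mul_le := by simp
  coeff_mul_eq := by simp
  xRep x y h := ⟨1, one_ne_zero, by simp⟩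

lemma IsMulX.one : W.IsMulX 1 X 1 where
  coprime := isCoprime_one_right
  natDegree_le := by simp
  coeff_eq := by simp
  natDegree_mul_le := by simp
  coeff_mul_eq := by simp
  xRep x y h := ⟨1, one_ne_zero, by simp⟩

/-- Applied to `(n+1)P` and `P`, the three forms are the coefficients of a quadratic form whose
roots are `x(nP)` and `x((n+2)P)`; dividing by the known factor gives the new one. The identity `n²
+ (n+2)² = 2(n+1)² + 2` governs both degrees and leading coefficients. -/
lemma IsMulX.step [IsSepClosed k] [W.IsElliptic] {n : ℕ} {f₀ g₀ f g : k[X]}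
    (h₀ : W.IsMulX n f₀ g₀) (h : W.IsMulX (n + 1) f g) : ∃ f' g', W.IsMulX (n + 2) f' g' := by
  have hf₀ : f₀ ≠ 0 := by
    rintro rfl
    simpa using h₀.coeff_eq
  have hex (x y : k) (hxy : W.toAffine.Nonsingular x y) : ∃ c a₀ a₁ b₀ b₁ : k, c ≠ 0 ∧
      ∃ d : k, d ≠ 0 ∧ (a₀ ≠ 0 ∨ a₁ ≠ 0) ∧
      f₀.eval x = d * a₀ ∧ g₀.eval x = d * a₁ ∧
      b₀ = ((n + 2) • Affine.Point.some x y hxy).xRep 0 ∧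
      b₁ = ((n + 2) • Affine.Point.some x y hxy).xRep 1 ∧
      (W.dupS f g).eval x = c * (b₀ * a₀) ∧ (W.dupT f g).eval x = c * (b₀ * a₁ + b₁ * a₀) ∧
      (dupU f g).eval x = c * (b₁ * a₁) := by
    obtain ⟨d, hd, hd₀, hd₁⟩ := h₀.xRep x y hxy
    obtain ⟨e, he, he₀, he₁⟩ := h.xRep x y hxy
    set P := Affine.Point.some x y hxy with hP
    obtain ⟨c, hc, hcP⟩ := addSubMap_sym2x ((n + 1) • P) P
    have e1 : (n + 1) • P + P = (n + 2) • P := by rw [← succ_nsmul]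
    have e2 : (n + 1) • P - P = n • P := by rw [succ_nsmul, add_sub_cancel_right]
    rw [e1, e2] at hcP
    have hP0 : P.xRep 0 = x := by simp [hP]
    have hP1 : P.xRep 1 = 1 := by simp [hP]
    refine ⟨e ^ 2 * c, _, _, _, _, mul_ne_zero (pow_ne_zero 2 he) hc, d, hd, ?_, hd₀, hd₁, rfl, rfl,
      ?_, ?_, ?_⟩
    · by_contra! hcon
      refine Affine.Point.xRep_ne_zero (n • P) ?_
      ext i
      fin_cases i
      exacts [hcon.1, hcon.2]
    · have := hcP 0
      simp [addSubMap, Affine.Point.sym2x, hP0, hP1] at this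
      rw [mul_assoc, ← this]
      simp [dupS, he₀, he₁]
      ring
    · have := hcP 1
      simp [addSubMap, Affine.Point.sym2x, hP0, hP1] at this
      rw [mul_assoc, add_comm (_ * _) (_ * _), add_comm (_ * _) (_ * _), ← this]
      simp [dupT, he₀, he₁]
      ring
    · have := hcP 2
      simp [addSubMap, Affine.Point.sym2x, hP0, hP1] at this
      rw [mul_assoc, ← this]
      simp [dupU, he₀, he₁]
      ring
  -- Checked by evaluation over an infinite field. The extra factor `Ψ₂Sq` discards those `x` that
  -- might carry no rational point.
  have hroot : dupU f g * f₀ ^ 2 - W.dupT f g * f₀ * g₀ + W.dupS f g * g₀ ^ 2 = 0 := by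
    have := IsSepClosed.infinite k
    refine (mul_eq_zero.mp (Polynomial.funext (q := 0) fun x => ?_)).resolve_left
      W.Ψ₂Sq_ne_zero_of_isElliptic
    rw [eval_mul, eval_zero]
    by_cases hx : W.Ψ₂Sq.eval x = 0
    · rw [hx, zero_mul]
    obtain ⟨y, hy⟩ := W.exists_nonsingular_of_eval_Ψ₂Sq_ne_zero hx
    obtain ⟨c, a₀, a₁, b₀, b₁, -, d, -, -, h1, h2, -, -, h3, h4, h5⟩ := hex x y hy
    simp only [eval_add, eval_sub, eval_mul, eval_pow, h1, h2, h3, h4, h5]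
    ring
  obtain ⟨f', g', hs, ht, hu⟩ := exists_factor_of_root h₀.coprime hf₀ hroot
  obtain ⟨hS, hS', hT, hT'⟩ := natDegree_dupS_dupT (W := W) h.natDegree_le h.coeff_eq
    h.natDegree_mul_le
  have hN : 2 * (n + 1) ^ 2 + 2 = n ^ 2 + (n + 2) ^ 2 := by ring
  rw [hN] at hS hS' hT hT'
  have hmon : f₀.Monic := monic_of_natDegree_le_of_coeff_eq_one _ h₀.natDegree_le h₀.coeff_eq
  have hdeg₀ : f₀.natDegree = n ^ 2 :=
    natDegree_eq_of_le_of_coeff_ne_zero h₀.natDegree_le (by rw [h₀.coeff_eq]; exact one_ne_zero)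
  have hle {p : k[X]} (hp : (f₀ * p).natDegree ≤ n ^ 2 + (n + 2) ^ 2) :
      p.natDegree ≤ (n + 2) ^ 2 := by
    rcases eq_or_ne p 0 with rfl | hp0
    · simp
    rw [hmon.natDegree_mul' hp0, hdeg₀] at hp
    omega
  have hf' : f'.natDegree ≤ (n + 2) ^ 2 := hle (by rw [hs]; exact hS)
  have hf'1 : f'.coeff ((n + 2) ^ 2) = 1 := by
    rw [← hs, coeff_mul_add_eq_of_natDegree_le h₀.natDegree_le hf', h₀.coeff_eq, one_mul] at hS'
    exact hS'
  have hXT : f₀ * (X * g') = X * W.dupT f g - f' * (X * g₀) := by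
    rw [← ht]; ring
  have hX1 : (f' * (X * g₀)).natDegree ≤ n ^ 2 + (n + 2) ^ 2 := by
    rw [add_comm]; exact natDegree_mul_le_of_le hf' h₀.natDegree_mul_le
  have hg' : (X * g').natDegree ≤ (n + 2) ^ 2 :=
    hle (by rw [hXT]; exact natDegree_sub_le_of_le hT hX1 |>.trans (by simp))
  refine ⟨f', g', isCoprime_of_dup W h.coprime hs ht hu, hf', hf'1, hg', ?_, fun x y hxy => ?_⟩
  · have := congrArg (coeff · (n ^ 2 + (n + 2) ^ 2)) hXT
    simp only [coeff_sub] at this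
    rw [coeff_mul_add_eq_of_natDegree_le h₀.natDegree_le hg', hT', add_comm (n ^ 2),
      coeff_mul_add_eq_of_natDegree_le hf' h₀.natDegree_mul_le, h₀.coeff_eq, hf'1,
      h₀.coeff_mul_eq, h.coeff_mul_eq] at this
    push_cast at this ⊢
    linear_combination this
  · obtain ⟨c, a₀, a₁, b₀, b₁, hc, d, hd, ha, h1, h2, hb₀, hb₁, h3, h4, h5⟩ := hex x y hxy
    rw [← hb₀, ← hb₁]
    rw [← hs, eval_mul, h1] at h3
    rw [← ht, eval_add, eval_mul, eval_mul, h1, h2] at h4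
    rw [← hu, eval_mul, h2] at h5
    refine ⟨c / d, div_ne_zero hc hd, ?_⟩
    rw [div_mul_eq_mul_div, div_mul_eq_mul_div, eq_div_iff hd, eq_div_iff hd]
    by_cases ha₁ : a₁ = 0
    · subst ha₁
      have ha₀ : a₀ ≠ 0 := by simpa using ha
      constructor
      · refine mul_left_cancel₀ ha₀ ?_
        linear_combination h3
      · refine mul_left_cancel₀ ha₀ ?_
        linear_combination h4
    · have key : eval x g' * d = c * b₁ := by
        refine mul_left_cancel₀ ha₁ ?_
        linear_combination h5
      refine ⟨mul_left_cancel₀ ha₁ ?_, key⟩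
      linear_combination h4 - a₀ * key

theorem exists_isMulX [IsSepClosed k] [W.IsElliptic] (n : ℕ) : ∃ f g, W.IsMulX n f g := by
  have : (∃ f g, W.IsMulX n f g) ∧ ∃ f g, W.IsMulX (n + 1) f g := by
    induction n with
    | zero => exact ⟨⟨_, _, .zero⟩, _, _, .one⟩
    | succ n ih =>
      obtain ⟨⟨f₀, g₀, h₀⟩, f, g, h⟩ := ih
      exact ⟨⟨f, g, h⟩, h₀.step h⟩
  exact this.1

end Mul
end WeierstrassCurve

/-! ### Fibres of multiplication by `n`: divisibility and torsion -/

open Polynomial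

/-- A pencil of coprime polynomials has only finitely many members with a factor in common with a
given nonzero polynomial. -/
lemma Polynomial.finite_setOf_not_isCoprime_sub_C_mul {k : Type*} [Field k] {f g r : k[X]}
    (hfg : IsCoprime f g) (hr : r ≠ 0) : {a : k | ¬ IsCoprime (f - C a * g) r}.Finite := by
  classical
  have hex (a : k) (ha : ¬ IsCoprime (f - C a * g) r) :
      ∃ q ∈ (UniqueFactorizationMonoid.normalizedFactors r).toFinset,
        Irreducible q ∧ q ∣ f - C a * g := by
    by_contra! hcon
    refine ha (isCoprime_of_irreducible_dvd (fun h => hr h.2) fun q hq h1 h2 => ?_)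
    obtain ⟨q', hq', hqq'⟩ := UniqueFactorizationMonoid.exists_mem_normalizedFactors_of_dvd hr hq h2
    exact hcon q' (Multiset.mem_toFinset.mpr hq') (hqq'.irreducible hq) (hqq'.symm.dvd.trans h1)
  choose! q hq using hex
  -- Each bad `a` picks an irreducible factor of `r`, and different `a` pick different ones: a
  -- factor shared by two members of the pencil would divide both `g` and `f`.
  refine Set.Finite.of_finite_image (f := q) (Set.Finite.subset (Finset.finite_toSet _)
    (Set.image_subset_iff.mpr fun a ha => (hq a ha).1)) fun a ha b hb hab => ?_
  by_contra hne
  obtain ⟨-, hirr, h1⟩ := hq a ha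
  obtain ⟨-, -, h2⟩ := hq b hb
  have hab : q a = q b := hab
  rw [← hab] at h2
  have hg : q a ∣ g := by
    have h3 : q a ∣ C (a - b) * g := by
      have := dvd_sub h2 h1
      rwa [show f - C b * g - (f - C a * g) = C (a - b) * g by rw [C_sub]; ring] at this
    have hu : IsUnit (C (a - b)) := (isUnit_iff_ne_zero.mpr (sub_ne_zero.mpr hne)).map C
    exact (hu.dvd_mul_left).mp h3
  have hf : q a ∣ f := by
    have := dvd_add h1 (hg.mul_left (C a))
    rwa [sub_add_cancel] at this
  exact hirr.not_isUnit (hfg.isUnit_of_dvd' hf hg)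

namespace WeierstrassCurve

section Div

variable {k : Type*} [Field k] {W : WeierstrassCurve k}

lemma infinite_point [IsSepClosed k] [W.IsElliptic] : Infinite W.toAffine.Point := by
  have := IsSepClosed.infinite k
  have hinf : {x : k | W.Ψ₂Sq.eval x ≠ 0}.Infinite := by
    have := (finite_setOfPred_isRoot W.Ψ₂Sq_ne_zero_of_isElliptic).infinite_compl
    exact this
  have hex (x : {x : k | W.Ψ₂Sq.eval x ≠ 0}) :=
    W.exists_nonsingular_of_eval_Ψ₂Sq_ne_zero x.2
  choose y hy using hex
  have := hinf.to_subtype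
  refine Infinite.of_injective (fun x => Affine.Point.some x.1 (y x) (hy x)) fun x x' h => ?_
  exact Subtype.ext (Affine.Point.some.inj h).1

variable [DecidableEq k]

/-- After multiplication by `X²`, the coefficient in degree `2n²` is `n²·n² - (n²·n² - n²) = n²`. -/
lemma IsMulX.wronskian_ne_zero {n : ℕ} {f g : k[X]} (h : W.IsMulX n f g) (hn : (n : k) ≠ 0) :
    derivative f * g - f * derivative g ≠ 0 := by
  have hD {p : k[X]} {N : ℕ} (hp : p.natDegree ≤ N) :
      (X * derivative p).natDegree ≤ N ∧ (X * derivative p).coeff N = N * p.coeff N := by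
    rcases N with _ | N
    · rw [eq_C_of_natDegree_le_zero hp]
      simp
    · refine ⟨(natDegree_mul_le_of_le natDegree_X_le ((natDegree_derivative_le p).trans
        (Nat.sub_le_sub_right hp 1))).trans (by omega), ?_⟩
      rw [coeff_X_mul, coeff_derivative]
      push_cast
      ring
  obtain ⟨hf, hf'⟩ := hD h.natDegree_le
  obtain ⟨hg, hg'⟩ := hD h.natDegree_mul_le
  rw [h.coeff_eq] at hf'
  rw [h.coeff_mul_eq] at hg'
  intro h0
  have key : X * derivative f * (X * g) - f * (X * derivative (X * g) - X * g) = 0 := by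
    rw [derivative_mul, derivative_X]
    linear_combination X ^ 2 * h0
  have hg2 : (X * derivative (X * g) - X * g).natDegree ≤ n ^ 2 :=
    (natDegree_sub_le_of_le hg h.natDegree_mul_le).trans (by simp)
  have := congrArg (coeff · (n ^ 2 + n ^ 2)) key
  simp only [coeff_sub, coeff_zero] at this
  rw [coeff_mul_add_eq_of_natDegree_le hf h.natDegree_mul_le,
    coeff_mul_add_eq_of_natDegree_le h.natDegree_le hg2, coeff_sub, hf', hg', h.coeff_eq,
    h.coeff_mul_eq] at this
  refine pow_ne_zero 2 hn ?_
  linear_combination this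

lemma IsMulX.natDegree_sub {n : ℕ} {f g : k[X]} (h : W.IsMulX n f g) (hn : n ≠ 0) (a : k) :
    (f - C a * g).natDegree = n ^ 2 := by
  have hn2 : 0 < n ^ 2 := by positivity
  have hg : g.natDegree < n ^ 2 := by
    rcases eq_or_ne g 0 with rfl | h0
    · simpa using hn2
    · have := h.natDegree_mul_le
      rw [natDegree_X_mul h0] at this
      omega
  have hag : (C a * g).natDegree < n ^ 2 := (natDegree_C_mul_le _ _).trans_lt hg
  refine natDegree_eq_of_le_of_coeff_ne_zero
    ((natDegree_sub_le_of_le h.natDegree_le hag.le).trans (by simp)) ?_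
  rw [coeff_sub, coeff_eq_zero_of_natDegree_lt hag, h.coeff_eq, sub_zero]
  exact one_ne_zero

variable [IsSepClosed k] [W.IsElliptic]

/-- For all but finitely many `a`, the `x`-coordinates of points `P` with `x(nP) = a` are the
`n ^ 2` different roots in `k` of a polynomial. -/
lemma IsMulX.exists_fibre {n : ℕ} {f g : k[X]} (h : W.IsMulX n f g) (hn : (n : k) ≠ 0) :
    ∃ r : k[X], r ≠ 0 ∧ ∀ a, r.eval a ≠ 0 → ∃ s : Finset k, s.card = n ^ 2 ∧
      ∀ x ∈ s, ∃ y, ∃ hxy : W.toAffine.Nonsingular x y, ∃ b, ∃ hb : W.toAffine.Nonsingular a b,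
        n • Affine.Point.some x y hxy = .some a b hb := by
  have hn0 : n ≠ 0 := by rintro rfl; simp at hn
  have hw := h.wronskian_ne_zero hn
  set w := derivative f * g - f * derivative g with hw'
  have hfin := finite_setOf_not_isCoprime_sub_C_mul h.coprime
    (mul_ne_zero hw W.Ψ₂Sq_ne_zero_of_isElliptic)
  refine ⟨∏ a ∈ hfin.toFinset, (X - C a), Finset.prod_ne_zero_iff.mpr fun a _ => X_sub_C_ne_zero a,
    fun a ha => ?_⟩
  have hcop : IsCoprime (f - C a * g) (w * W.Ψ₂Sq) := by
    by_contra hcon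
    refine ha ?_
    rw [eval_prod]
    exact Finset.prod_eq_zero (hfin.mem_toFinset.mpr hcon) (by simp)
  have hsep : (f - C a * g).Separable := by
    -- Modulo `f - a g`, the Wronskian equals `g` times the derivative of `f - a g`.
    have h1 : IsCoprime (f - C a * g) (g * derivative (f - C a * g)) := by
      have h2 := (IsCoprime.mul_right_iff.mp hcop).1
      rw [show w = g * derivative (f - C a * g) + (f - C a * g) * (- derivative g) by
        rw [hw', derivative_sub, derivative_C_mul]; ring] at h2
      exact IsCoprime.of_add_mul_left_right h2
    exact (IsCoprime.mul_right_iff.mp h1).2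
  have hp0 : f - C a * g ≠ 0 := hsep.ne_zero
  refine ⟨(f - C a * g).roots.toFinset, ?_, fun x hx => ?_⟩
  · rw [Multiset.toFinset_card_of_nodup (nodup_roots hsep),
      ← (IsSepClosed.splits_of_separable _ hsep).natDegree_eq_card_roots, h.natDegree_sub hn0]
  have hx0 : f.eval x - a * g.eval x = 0 := by
    have := (mem_roots hp0).mp (Multiset.mem_toFinset.mp hx)
    simpa using this
  have hΨ : W.Ψ₂Sq.eval x ≠ 0 := by
    intro h0
    obtain ⟨u, v, huv⟩ := (IsCoprime.mul_right_iff.mp hcop).2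
    have := congrArg (eval x) huv
    simp [h0, hx0] at this
  obtain ⟨y, hy⟩ := W.exists_nonsingular_of_eval_Ψ₂Sq_ne_zero hΨ
  obtain ⟨c, hc, h1, h2⟩ := h.xRep x y hy
  refine ⟨y, hy, ?_⟩
  have hg0 : g.eval x ≠ 0 := by
    intro h0
    rw [h0, mul_zero, sub_zero] at hx0
    obtain ⟨u, v, huv⟩ := h.coprime
    have := congrArg (eval x) huv
    simp [h0, hx0] at this
  rcases hP : n • Affine.Point.some x y hy with _ | ⟨a', b, hb⟩
  · rw [hP, ← Affine.Point.zero_def] at h2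
    simp [hg0] at h2
  · rw [hP] at h1 h2
    simp at h1 h2
    have : a' = a := by
      refine mul_left_cancel₀ hc ?_
      rw [← h1, ← h2]
      linear_combination hx0
    subst this
    exact ⟨b, hb, rfl⟩

/-- All but finitely many points are multiples of `n`. As there are infinitely many points, some `R`
has both `R` and `Q + R` of this kind, and `Q` is their difference. -/
theorem exists_nsmul_eq {n : ℕ} (hn : (n : k) ≠ 0) (Q : W.toAffine.Point) : ∃ P, n • P = Q := by
  have := infinite_point (W := W)
  obtain ⟨f, g, h⟩ := exists_isMulX (W := W) n
  obtain ⟨r, hr, hfib⟩ := h.exists_fibre hn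
  have hn0 : n ≠ 0 := by rintro rfl; simp at hn
  let B := {P : W.toAffine.Point | ∀ x y h, P = .some x y h → r.eval x = 0}
  have hB : B.Finite := W.finite_points_of_root hr
  have good (R : W.toAffine.Point) (hR : R ∉ B) : ∃ P, n • P = R := by
    simp only [B, Set.mem_ofPred_eq, not_forall] at hR
    obtain ⟨a, b, hab, rfl, ha⟩ := hR
    obtain ⟨s, hs, hfib⟩ := hfib a ha
    obtain ⟨x, hx⟩ := Finset.card_pos.mp (hs ▸ Nat.pos_of_ne_zero (pow_ne_zero 2 hn0))
    obtain ⟨y, hy, b', hb', hP⟩ := hfib x hx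
    rcases (Affine.Point.X_eq_iff (h₁ := hb') (h₂ := hab)).mp rfl with h | h
    · exact ⟨_, hP.trans h⟩
    · exact ⟨-_, by rw [smul_neg, hP, h, neg_neg]⟩
  have hB' : ((fun R => Q + R) ⁻¹' B).Finite := hB.preimage (add_right_injective Q).injOn
  obtain ⟨R, hR⟩ := (hB.union hB').infinite_compl.nonempty
  simp only [Set.mem_compl_iff, Set.mem_union, not_or] at hR
  obtain ⟨P₁, h₁⟩ := good R hR.1
  obtain ⟨P₂, h₂⟩ := good (Q + R) hR.2
  exact ⟨P₂ - P₁, by rw [smul_sub, h₁, h₂, add_sub_cancel_right]⟩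

/-- Two points with different `x`-coordinates in one fibre have equal or opposite multiples, so
their difference or sum is the required torsion point. -/
theorem exists_ne_zero_nsmul_eq_zero {n : ℕ} (hn : (n : k) ≠ 0) (hn1 : 1 < n) :
    ∃ P : W.toAffine.Point, P ≠ 0 ∧ n • P = 0 := by
  have := IsSepClosed.infinite k
  obtain ⟨f, g, h⟩ := exists_isMulX (W := W) n
  obtain ⟨r, hr, hfib⟩ := h.exists_fibre hn
  obtain ⟨a, ha⟩ := (finite_setOfPred_isRoot hr).infinite_compl.nonempty
  obtain ⟨s, hs, hfib⟩ := hfib a ha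
  obtain ⟨x, hx, x', hx', hne⟩ := Finset.one_lt_card.mp (hs ▸ Nat.one_lt_pow two_ne_zero hn1)
  obtain ⟨y, hy, b, hb, hP⟩ := hfib x hx
  obtain ⟨y', hy', b', hb', hP'⟩ := hfib x' hx'
  rcases (Affine.Point.X_eq_iff (h₁ := hb) (h₂ := hb')).mp rfl with h | h
  · refine ⟨.some x y hy - .some x' y' hy', fun h0 => hne ?_, by rw [smul_sub, hP, hP', h, sub_self]⟩
    exact Affine.Point.X_eq_iff.mpr (Or.inl (sub_eq_zero.mp h0))
  · refine ⟨.some x y hy + .some x' y' hy', fun h0 => hne ?_, by rw [smul_add, hP, hP', h,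
      neg_add_cancel]⟩
    exact Affine.Point.X_eq_iff.mpr (Or.inr (eq_neg_of_add_eq_zero_left h0))

theorem finite_setOf_nsmul_eq_zero {n : ℕ} (hn : (n : k) ≠ 0) :
    {P : W.toAffine.Point | n • P = 0}.Finite := by
  obtain ⟨f, g, h⟩ := exists_isMulX (W := W) n
  have hg : g ≠ 0 := by
    rintro rfl
    have := h.coeff_mul_eq
    simp only [mul_zero, coeff_zero] at this
    exact pow_ne_zero 2 hn this.symm
  refine (W.finite_points_of_root hg).subset ?_
  rintro _ hP x y hxy rfl
  obtain ⟨c, -, -, h2⟩ := h.xRep x y hxy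
  rw [Set.mem_ofPred_eq] at hP
  rw [h2, hP]
  simp

end Div
end WeierstrassCurve


/-! ### Group rings mapping onto endomorphism rings -/

open Module

namespace Representation

variable {k G V : Type*} [Field k] [Group G] [AddCommGroup V] [Module k V]

lemma conj_mem_range_asAlgebraHom (ρ : Representation k G V) (N : Subgroup G) [N.Normal] (σ : G)
    {b : Module.End k V} (hb : b ∈ (asAlgebraHom (ρ.comp N.subtype)).range) :
    ρ σ * b * ρ σ⁻¹ ∈ (asAlgebraHom (ρ.comp N.subtype)).range := by
  obtain ⟨a, rfl⟩ := hb
  induction a using MonoidAlgebra.induction_on with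
  | of n =>
    refine ⟨MonoidAlgebra.of k N ⟨σ * n * σ⁻¹, Subgroup.Normal.conj_mem ‹_› _ n.2 σ⟩, ?_⟩
    simp
  | add a b ha hb =>
    rw [map_add, mul_add, add_mul]
    exact add_mem ha hb
  | smul c a ha =>
    have := Subalgebra.smul_mem _ ha c
    rw [← smul_mul_assoc, ← mul_smul_comm] at this
    simpa using this

/-- If the image of `ρ` contains all transvections and `N` contains all commutators, then
`k[N]` maps onto `End V`. -/
theorem asAlgebraHom_surjective_of_commutator_le [Module.Finite k V] (h2 : (2 : k) ≠ 0)
    (ρ : Representation k G V)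
    (hρ : ∀ (f : Dual k V) (v : V), f v = 0 → ∃ σ, ρ σ = LinearMap.transvection f v)
    (N : Subgroup G) (hN : commutator G ≤ N) :
    Function.Surjective (asAlgebraHom (ρ.comp N.subtype)) := by
  have hnormal : N.Normal := ⟨fun n hn g => by
    have : g * n * g⁻¹ * n⁻¹ ∈ N :=
      hN (Subgroup.commutator_mem_commutator (Subgroup.mem_top g) (Subgroup.mem_top n))
    simpa using N.mul_mem this hn⟩
  set B := (asAlgebraHom (ρ.comp N.subtype)).range with hB
  have hinv {f : Dual k V} {v : V} (hfv : f v = 0) {σ : G} (hσ : ρ σ = LinearMap.transvection f v)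
      (x : V) : ρ σ⁻¹ x = x - f x • v := by
    have : ρ σ (x - f x • v) = x := by
      rw [hσ]; simp [LinearMap.transvection.apply, hfv]
    conv_lhs => rw [← this]
    exact ρ.inv_self_apply σ _
  -- rank one nilpotent endomorphisms
  have nilp (f : Dual k V) (v : V) (hfv : f v = 0) : f.smulRight v ∈ B := by
    rcases eq_or_ne f 0 with rfl | hf
    · simp
    rcases eq_or_ne v 0 with rfl | hv
    · simp
    obtain ⟨u, hu⟩ : ∃ u, f u = 1 := by
      obtain ⟨u, hu⟩ := DFunLike.ne_iff.mp hf
      exact ⟨(f u)⁻¹ • u, by simpa using inv_mul_cancel₀ hu⟩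
    obtain ⟨g, hgv, hgu⟩ : ∃ g : Dual k V, g v = 1 ∧ g u = 0 := by
      obtain ⟨g, hg⟩ := Projective.exists_dual_eq_one k hv
      exact ⟨g - g u • f, by simp [hg, hfv], by simp [hu]⟩
    obtain ⟨τ, hτ⟩ := hρ f v hfv
    obtain ⟨σ, hσ⟩ := hρ g u hgu
    have hmem : σ * τ * σ⁻¹ * τ⁻¹ ∈ N :=
      hN (Subgroup.commutator_mem_commutator (Subgroup.mem_top σ) (Subgroup.mem_top τ))
    have hb : ρ (σ * τ * σ⁻¹ * τ⁻¹) ∈ B :=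
      ⟨MonoidAlgebra.of k N ⟨_, hmem⟩, by simp⟩
    have hbv : ρ (σ * τ * σ⁻¹ * τ⁻¹) v = -u := by
      simp only [map_mul, Module.End.mul_apply, hinv hfv hτ, hinv hgu hσ, hσ, hτ,
        LinearMap.transvection.apply, map_sub, map_add, map_smul, hfv, hgv, hu, hgu]
      simp
    set b := ρ (σ * τ * σ⁻¹ * τ⁻¹) with hb'
    have h1 := conj_mem_range_asAlgebraHom ρ N τ hb
    have h3 := conj_mem_range_asAlgebraHom ρ N τ⁻¹ hb
    -- With `n = f.smulRight v` and `n² = 0`, the second difference of `b` under conjugation by `1 ±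
    -- n` is `-2nbn`; since `b v = -u` and `f u = 1`, one has `nbn = -n`.
    have key : f.smulRight v =
        (2 : k)⁻¹ • (ρ τ * b * ρ τ⁻¹ + ρ τ⁻¹ * b * ρ τ⁻¹⁻¹) - b := by
      ext x
      rw [inv_inv]
      simp only [LinearMap.smulRight_apply, LinearMap.sub_apply, LinearMap.smul_apply,
        LinearMap.add_apply, Module.End.mul_apply, hinv hfv hτ, hτ, LinearMap.transvection.apply,
        map_sub, map_add, map_smul, hbv, map_neg, hu, smul_neg]
      match_scalars <;> field_simp <;> ring
    rw [key]
    exact B.sub_mem (B.smul_mem (B.add_mem h1 h3) _) hb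
  have rank_one (f : Dual k V) (v : V) : f.smulRight v ∈ B := by
    by_cases hfv : f v = 0
    · exact nilp f v hfv
    -- A vector `w` in the kernel writes `f.smulRight v` as a product of two nilpotent maps; with no
    -- such `w`, the space is a line and the map is a scalar.
    by_cases hker : ∃ w, f w = 0 ∧ w ≠ 0
    · obtain ⟨w, hfw, hw⟩ := hker
      obtain ⟨g, hg⟩ := Projective.exists_dual_eq_one k hw
      have hgv : (g - (g v / f v) • f) v = 0 := by simp [hfv]
      have hgw : (g - (g v / f v) • f) w = 1 := by simp [hg, hfw]
      have : f.smulRight v = (g - (g v / f v) • f).smulRight v * f.smulRight w := by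
        ext x
        simp only [LinearMap.smulRight_apply, Module.End.mul_apply, map_smul, hgw, one_smul]
      rw [this]
      exact B.mul_mem (nilp _ _ hgv) (nilp _ _ hfw)
    · push Not at hker
      have : f.smulRight v = algebraMap k (Module.End k V) (f v) := by
        ext x
        refine sub_eq_zero.mp (hker _ ?_)
        simp [mul_comm]
      rw [this]
      exact B.algebraMap_mem _
  intro φ
  suffices φ ∈ B from this
  let b := Module.finBasis k V
  have : φ = ∑ i, (b.coord i).smulRight (φ (b i)) := by
    refine b.ext fun j => ?_
    simp [LinearMap.sum_apply, Finsupp.single_apply, ite_smul]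
  rw [this]
  exact B.sum_mem fun i _ => rank_one _ _

end Representation

namespace EllFull

variable {k : Type u} {N : Type v} {V : Type w} [Field k] [Group N] [AddCommGroup V] [Module k V]

/-- A stable subspace over `K` is stable under all base-changed endomorphisms. Rank one maps send a
vector with nonzero `i`-th coordinate to a nonzero multiple of `1 ⊗ v`, for any `v`. -/
theorem isAbsolutelySimple_of_surjective [Nontrivial V] [Module.Finite k V]
    (ρ : Representation k N V) (h : Function.Surjective ρ.asAlgebraHom) :
    IsAbsolutelySimple ρ := by
  intro K _ _
  have stable (M : Subrepresentation (baseChangeRep K ρ)) (φ : Module.End k V) (m : K ⊗[k] V)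
      (hm : m ∈ M.toSubmodule) : φ.baseChange K m ∈ M.toSubmodule := by
    obtain ⟨a, rfl⟩ := h φ
    induction a using MonoidAlgebra.induction_on with
    | of n =>
      rw [Representation.asAlgebraHom_of]
      exact M.apply_mem_toSubmodule n hm
    | add a b ha hb =>
      rw [map_add, LinearMap.baseChange_add]
      exact add_mem ha hb
    | smul c a ha =>
      rw [map_smul, LinearMap.baseChange_smul, LinearMap.smul_apply]
      exact M.toSubmodule.smul_of_tower_mem c ha
  let b := Module.finBasis k V
  let bK := b.baseChange K
  have coord (v : V) (i) (m : K ⊗[k] V) :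
      ((b.coord i).smulRight v).baseChange K m = bK.repr m i ⊗ₜ[k] v := by
    suffices ((b.coord i).smulRight v).baseChange K =
        (bK.coord i).smulRight ((1 : K) ⊗ₜ[k] v) by
      rw [this]
      simp [TensorProduct.smul_tmul']
    refine bK.ext fun j => ?_
    simp [bK, Finsupp.single_apply, ite_smul, TensorProduct.tmul_ite]
  have key (M : Subrepresentation (baseChangeRep K ρ)) (hM : M.toSubmodule ≠ ⊥) :
      M.toSubmodule = ⊤ := by
    obtain ⟨m, hm, hm0⟩ := Submodule.exists_mem_ne_zero_of_ne_bot hM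
    obtain ⟨i, hi⟩ : ∃ i, bK.repr m i ≠ 0 := by
      by_contra! hcon
      exact hm0 (bK.repr.map_eq_zero_iff.mp (Finsupp.ext hcon))
    have hv (c : K) (v : V) : c ⊗ₜ[k] v ∈ M.toSubmodule := by
      have := M.toSubmodule.smul_mem (c / bK.repr m i) (stable M ((b.coord i).smulRight v) m hm)
      rwa [coord, TensorProduct.smul_tmul', smul_eq_mul, div_mul_cancel₀ _ hi] at this
    refine eq_top_iff.mpr fun z _ => ?_
    induction z using TensorProduct.induction_on with
    | zero => exact zero_mem _
    | tmul c v => exact hv c v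
    | add x y hx hy => exact add_mem (hx trivial) (hy trivial)
  have : Nontrivial (Subrepresentation (baseChangeRep K ρ)) := by
    refine ⟨⊥, ⊤, fun h => ?_⟩
    have h' : (⊥ : Submodule K (K ⊗[k] V)) = ⊤ :=
      congrArg Subrepresentation.toSubmodule h
    exact bot_ne_top h'
  refine ⟨fun M => ?_⟩
  by_cases hM : M.toSubmodule = ⊥
  · exact Or.inl (Subrepresentation.toSubmodule_injective hM)
  · exact Or.inr (Subrepresentation.toSubmodule_injective (key M hM))

end EllFull

/-! ### The Tate module of an `ℓ`-divisible group -/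

namespace EllFull

variable (ℓ : ℕ)

section TateModule

variable {A : Type u} [AddCommGroup A]

namespace TateModule

variable {ℓ}

lemma apply_zero (f : TateModule ℓ A) : f.1 0 = 0 := by simpa using (f.2 0).1

lemma exists_apply_one_eq (hdiv : ∀ a : A, ∃ b, ℓ • b = a) {a : A} (ha : ℓ • a = 0) :
    ∃ f : TateModule ℓ A, f.1 1 = a := by
  choose d hd using hdiv
  -- The factor `ℓ` shifts the index: component `0` is `ℓ • a = 0` and component `1` is `ℓ • d a =
  -- a`.
  refine ⟨⟨fun n => ℓ • (d^[n]) a, fun n => ⟨?_, ?_⟩⟩, ?_⟩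
  · induction n with
    | zero => simpa using ha
    | succ n ih =>
      simp only at ih ⊢
      rw [pow_succ, mul_smul, Function.iterate_succ_apply', hd]
      exact ih
  · simp only
    rw [Function.iterate_succ_apply', hd]
  · simp [hd]

variable [Fact ℓ.Prime]

lemma natCast_smul_apply (m : ℕ) (f : TateModule ℓ A) (n : ℕ) :
    (((m : ℤ_[ℓ]) • f : TateModule ℓ A).1 n : A) = m • f.1 n := by
  rw [Nat.cast_smul_eq_nsmul]
  rfl

lemma prime_smul_apply_succ (f : TateModule ℓ A) (n : ℕ) :
    (((ℓ : ℤ_[ℓ]) • f : TateModule ℓ A).1 (n + 1) : A) = f.1 n := by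
  rw [natCast_smul_apply, (f.2 n).2]

lemma prime_smul_injective : Function.Injective fun f : TateModule ℓ A => (ℓ : ℤ_[ℓ]) • f := by
  intro f g h
  ext n
  rw [← prime_smul_apply_succ f, ← prime_smul_apply_succ g]
  exact congrArg (fun x : TateModule ℓ A => x.1 (n + 1)) h

instance : IsTorsionFree ℤ_[ℓ] (TateModule ℓ A) := by
  refine .of_smul_eq_zero fun z f h => or_iff_not_imp_left.mpr fun hz => ?_
  have hp (n : ℕ) (g : TateModule ℓ A) (hg : (ℓ : ℤ_[ℓ]) ^ n • g = 0) : g = 0 := by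
    induction n with
    | zero => simpa using hg
    | succ n ih =>
      refine ih (prime_smul_injective ?_)
      rw [pow_succ', mul_smul] at hg
      simpa using hg
  rw [PadicInt.unitCoeff_spec hz, mul_smul] at h
  exact hp _ _ ((smul_eq_zero_iff_eq (PadicInt.unitCoeff hz)).mp h)

/-- An element of the Tate module with trivial first component is divisible by `ℓ`. -/
lemma exists_prime_smul_eq {f : TateModule ℓ A} (hf : f.1 1 = 0) :
    ∃ g : TateModule ℓ A, (ℓ : ℤ_[ℓ]) • g = f := by
  refine ⟨⟨fun n => f.1 (n + 1), fun n => ⟨?_, (f.2 (n + 1)).2⟩⟩, ?_⟩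
  · induction n with
    | zero => simpa using hf
    | succ n ih => rw [pow_succ, mul_smul, (f.2 (n + 1)).2, ih]
  · ext n
    rw [natCast_smul_apply]
    exact (f.2 n).2

/-- Lifts of the elements of `A[ℓ]` generate. Successive approximation solves for coefficients at
each level `n`, and compactness of a finite power of `ℤ_ℓ` gives a solution at all levels at once.
-/
theorem finite [Finite (AddSubgroup.torsionBy A (ℓ : ℤ))] (hdiv : ∀ a : A, ∃ b, ℓ • b = a) :
    Module.Finite ℤ_[ℓ] (TateModule ℓ A) := by
  have := Fintype.ofFinite (AddSubgroup.torsionBy A (ℓ : ℤ))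
  classical
  have hlift (a : AddSubgroup.torsionBy A (ℓ : ℤ)) : ∃ f : TateModule ℓ A, f.1 1 = a :=
    exists_apply_one_eq hdiv (AddSubgroup.torsionBy.nsmul_iff.mp a.2)
  choose t ht using hlift
  let φ := Fintype.linearCombination ℤ_[ℓ] t
  have hφ (z) (n : ℕ) : (φ z).1 n = ∑ a, (PadicInt.toZModPow n (z a)).val • (t a).1 n := by
    simp only [φ, Fintype.linearCombination_apply]
    rw [AddSubgroup.val_finsetSum, Finset.sum_apply]
    rfl
  have hex (n : ℕ) : ∀ f : TateModule ℓ A, ∃ z, (φ z).1 n = f.1 n := by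
    induction n with
    | zero => exact fun f => ⟨0, by rw [apply_zero, apply_zero]⟩
    | succ n ih =>
      intro f
      let a : AddSubgroup.torsionBy A (ℓ : ℤ) := ⟨f.1 1, by
        rw [AddSubgroup.torsionBy.nsmul_iff]
        simpa using (f.2 1).1⟩
      obtain ⟨g, hg⟩ := exists_prime_smul_eq (f := f - t a) (by simp [ht, a])
      obtain ⟨z, hz⟩ := ih g
      refine ⟨Pi.single a 1 + (ℓ : ℤ_[ℓ]) • z, ?_⟩
      rw [map_add, map_smul, AddSubgroup.coe_add, Pi.add_apply, prime_smul_apply_succ, hz,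
        ← prime_smul_apply_succ g, hg]
      simp [φ, Fintype.linearCombination_apply_single]
  have hsurj : Function.Surjective φ := by
    intro f
    have hne := IsCompact.nonempty_iInter_of_sequence_nonempty_isCompact_isClosed
      (fun n => {z | (φ z).1 n = f.1 n}) (fun n z hz => ?_) (fun n => hex n f) ?_ fun n => ?_
    · obtain ⟨z, hz⟩ := hne
      exact ⟨z, Subtype.ext (funext fun n => Set.mem_iInter.mp hz n)⟩
    · have hz : (φ z).1 (n + 1) = f.1 (n + 1) := hz
      change (φ z).1 n = f.1 n
      rw [← ((φ z).2 n).2, hz, (f.2 n).2]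
    · have : {z | (φ z).1 0 = f.1 0} = Set.univ :=
        Set.eq_univ_of_forall fun z => by
          change (φ z).1 0 = f.1 0
          rw [apply_zero, apply_zero]
      rw [this]
      exact isCompact_univ
    -- The condition at level `n` depends only on `z` modulo `ℓ^n`.
    · refine isClosed_of_closure_subset fun z hz => ?_
      have hpos : (0 : ℝ) < (ℓ : ℝ) ^ (-n : ℤ) :=
        zpow_pos (Nat.cast_pos.mpr (Fact.out : ℓ.Prime).pos) _
      obtain ⟨z', hz', hd⟩ := Metric.mem_closure_iff.mp hz _ hpos
      have hz' : (φ z').1 n = f.1 n := hz'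
      change (φ z).1 n = f.1 n
      rw [← hz', hφ, hφ]
      refine Finset.sum_congr rfl fun a _ => ?_
      have h1 : ‖z a - z' a‖ ≤ (ℓ : ℝ) ^ (-n : ℤ) := by
        rw [← dist_eq_norm]
        exact ((dist_pi_lt_iff hpos).mp hd a).le
      rw [PadicInt.norm_le_pow_iff_mem_span_pow, ← PadicInt.ker_toZModPow, RingHom.mem_ker,
        map_sub, sub_eq_zero] at h1
      rw [h1]
  exact Module.Finite.of_surjective φ hsurj

/-- Reduction of the Tate module. -/
def evalOne : TateModule ℓ A →+ AddSubgroup.torsionBy A (ℓ : ℤ) where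
  toFun f := ⟨f.1 1, by
    rw [AddSubgroup.torsionBy.nsmul_iff]
    simpa using (f.2 1).1⟩
  map_zero' := rfl
  map_add' _ _ := rfl

/-- The map `T/ℓT → A[ℓ]` induced by `evalOne`. -/
def reductionEval : Reduction ℓ (TateModule ℓ A) →+ AddSubgroup.torsionBy A (ℓ : ℤ) :=
  QuotientAddGroup.lift
    (LinearMap.range (LinearMap.lsmul ℤ_[ℓ] (TateModule ℓ A) (ℓ : ℤ_[ℓ]))).toAddSubgroup
    evalOne (by
      rintro _ ⟨g, rfl⟩
      refine Subtype.ext ?_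
      exact (prime_smul_apply_succ g 0).trans (apply_zero g))

/-- For an `ℓ`-divisible group `A`, the reduction of the Tate module is `A[ℓ]`. -/
def reductionEquiv (hdiv : ∀ a : A, ∃ b, ℓ • b = a) :
    Reduction ℓ (TateModule ℓ A) ≃ₗ[ZMod ℓ] AddSubgroup.torsionBy A (ℓ : ℤ) :=
  LinearEquiv.ofBijective (AddMonoidHom.toZModLinearMap ℓ reductionEval) (by
    constructor
    · rw [injective_iff_map_eq_zero]
      intro x hx
      obtain ⟨f, rfl⟩ := Submodule.Quotient.mk_surjective _ x
      obtain ⟨g, rfl⟩ := exists_prime_smul_eq (f := f) (congrArg Subtype.val hx)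
      exact (Submodule.Quotient.mk_eq_zero _).mpr ⟨g, rfl⟩
    · intro a
      obtain ⟨f, hf⟩ := exists_apply_one_eq hdiv (AddSubgroup.torsionBy.nsmul_iff.mp a.2)
      exact ⟨Submodule.Quotient.mk f, Subtype.ext hf⟩)

lemma reductionEquiv_reductionRep {G : Type v} [Group G] (hdiv : ∀ a : A, ∃ b, ℓ • b = a)
    (φ : G →* AddMonoid.End A) (g : G) (x : Reduction ℓ (TateModule ℓ A)) :
    reductionEquiv hdiv (reductionRep ℓ (tateRep ℓ φ) g x) =
      torsionRep ℓ φ g (reductionEquiv hdiv x) := by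
  obtain ⟨f, rfl⟩ := Submodule.Quotient.mk_surjective _ x
  rfl

end TateModule

end TateModule

/-! ### From reduction modulo `ℓ` to well-roundedness -/

section WellRounded

variable {ℓ} [Fact ℓ.Prime] {N : Type v} {S : Type w} [Group N] [AddCommGroup S] [Module ℤ_[ℓ] S]

lemma exists_lift_asAlgebraHom_reductionRep (ρ : Representation ℤ_[ℓ] N S)
    (a : MonoidAlgebra (ZMod ℓ) N) : ∃ b : MonoidAlgebra ℤ_[ℓ] N, ∀ x : S,
      (Submodule.Quotient.mk (ρ.asAlgebraHom b x) : Reduction ℓ S) =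
        (reductionRep ℓ ρ).asAlgebraHom a (Submodule.Quotient.mk x) := by
  induction a using MonoidAlgebra.induction_on with
  | of n =>
    refine ⟨MonoidAlgebra.of _ _ n, fun x => ?_⟩
    rw [Representation.asAlgebraHom_of, Representation.asAlgebraHom_of]
    rfl
  | add a₁ a₂ h₁ h₂ =>
    obtain ⟨b₁, h₁⟩ := h₁
    obtain ⟨b₂, h₂⟩ := h₂
    refine ⟨b₁ + b₂, fun x => ?_⟩
    rw [map_add, map_add, LinearMap.add_apply, LinearMap.add_apply, Submodule.Quotient.mk_add,
      h₁, h₂]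
  | smul c a h =>
    obtain ⟨b, h⟩ := h
    refine ⟨(c.val : ℤ_[ℓ]) • b, fun x => ?_⟩
    rw [map_smul, map_smul, LinearMap.smul_apply, LinearMap.smul_apply, ← h,
      Submodule.Quotient.mk_smul, Nat.cast_smul_eq_nsmul]
    conv_rhs => rw [← ZMod.natCast_zmod_val c, Nat.cast_smul_eq_nsmul]

/-- Surjectivity of `ℤ_ℓ[N] → End S` may be tested modulo `ℓ`. -/
theorem asAlgebraHom_surjective_of_reductionRep [Module.Free ℤ_[ℓ] S] [Module.Finite ℤ_[ℓ] S]
    (ρ : Representation ℤ_[ℓ] N S)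
    (h : Function.Surjective (reductionRep ℓ ρ).asAlgebraHom) :
    Function.Surjective ρ.asAlgebraHom := by
  have key : (⊤ : Submodule ℤ_[ℓ] (Module.End ℤ_[ℓ] S)) ≤
      LinearMap.range ρ.asAlgebraHom.toLinearMap := by
    -- Nakayama over the local ring `ℤ_ℓ`: it suffices that the image and `ℓ End(S)` together span
    -- `End(S)`.
    refine Submodule.le_of_le_smul_of_le_jacobson_bot (I := Ideal.span {(ℓ : ℤ_[ℓ])})
      Module.Finite.fg_top ?_ fun φ _ => ?_
    · rw [← PadicInt.maximalIdeal_eq_span_p]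
      exact IsLocalRing.maximalIdeal_le_jacobson _
    · let φ' : Module.End (ZMod ℓ) (Reduction ℓ S) := AddMonoidHom.toZModLinearMap ℓ
        (Submodule.mapQ (LinearMap.range (LinearMap.lsmul ℤ_[ℓ] S (ℓ : ℤ_[ℓ])))
          (LinearMap.range (LinearMap.lsmul ℤ_[ℓ] S (ℓ : ℤ_[ℓ]))) φ (by
            rintro _ ⟨x, rfl⟩
            exact ⟨φ x, by simp⟩)).toAddMonoidHom
      obtain ⟨a, ha⟩ := h φ'
      obtain ⟨b, hb⟩ := exists_lift_asAlgebraHom_reductionRep ρ a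
      have hdiv (x : S) : ∃ y : S, (ℓ : ℤ_[ℓ]) • y = (φ - ρ.asAlgebraHom b) x := by
        have h0 : (Submodule.Quotient.mk (φ x - ρ.asAlgebraHom b x) : Reduction ℓ S) = 0 := by
          rw [Submodule.Quotient.mk_sub, hb, ha]
          exact sub_self _
        exact (Submodule.Quotient.mk_eq_zero _).mp h0
      choose y hy using hdiv
      let β := Module.finBasis ℤ_[ℓ] S
      -- The chosen quotients `y` need not be linear; only their values on a basis are used.
      have hψ : φ - ρ.asAlgebraHom b = (ℓ : ℤ_[ℓ]) • β.constr ℤ_[ℓ] fun i => y (β i) := by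
        refine β.ext fun i => ?_
        rw [LinearMap.smul_apply, Basis.constr_basis, hy]
      rw [← add_sub_cancel (ρ.asAlgebraHom b) φ, hψ]
      exact Submodule.add_mem_sup ⟨b, rfl⟩
        (Submodule.smul_mem_smul (Ideal.mem_span_singleton_self _) trivial)
  intro φ
  exact key (Submodule.mem_top (x := φ))

lemma baseChangeHom_injective [Module.Free ℤ_[ℓ] S] :
    Function.Injective (Module.End.baseChangeHom ℤ_[ℓ] ℚ_[ℓ] S) := by
  intro φ ψ h
  let β := Module.Free.chooseBasis ℤ_[ℓ] S
  ext x
  refine β.repr.injective (Finsupp.ext fun i => ?_)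
  have h1 : φ.baseChange ℚ_[ℓ] (1 ⊗ₜ x) = ψ.baseChange ℚ_[ℓ] (1 ⊗ₜ x) := LinearMap.congr_fun h _
  rw [LinearMap.baseChange_tmul, LinearMap.baseChange_tmul] at h1
  have h2 := congrArg (fun m => (β.baseChange ℚ_[ℓ]).repr m i) h1
  exact PadicInt.ext (by simpa [Algebra.smul_def] using h2)

/-- Well-roundedness follows from surjectivity of the group ring modulo `ℓ`. -/
theorem isWellRounded_of_surjective [Module.Free ℤ_[ℓ] S] [Module.Finite ℤ_[ℓ] S]
    [Nontrivial (Reduction ℓ S)] [Module.Finite (ZMod ℓ) (Reduction ℓ S)]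
    (ρ : Representation ℤ_[ℓ] N S)
    (h : Function.Surjective (reductionRep ℓ ρ).asAlgebraHom) : IsWellRounded ℓ ρ where
  free := inferInstance
  finite := inferInstance
  surjective := asAlgebraHom_surjective_of_reductionRep ρ h
  absolutelySimple := isAbsolutelySimple_of_surjective _ h
  image_equiv_matrix := by
    have hr : (groupRingToEnd ℓ ρ).range = (Module.End.baseChangeHom ℤ_[ℓ] ℚ_[ℓ] S).range := by
      rw [groupRingToEnd, AlgHom.range_comp, (AlgHom.range_eq_top _).mpr
        (asAlgebraHom_surjective_of_reductionRep ρ h), Algebra.map_top]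
    exact ⟨((Subalgebra.equivOfEq _ _ hr).trans
      (AlgEquiv.ofInjective _ baseChangeHom_injective).symm).trans
        (algEquivMatrix (Module.finBasis ℤ_[ℓ] S))⟩

end WellRounded

end EllFull

/-- Fullness of the image of a group ring is invariant under equivariant isomorphisms. -/
lemma Representation.asAlgebraHom_surjective_of_equiv {k G V V' : Type*} [CommRing k] [Group G]
    [AddCommGroup V] [Module k V] [AddCommGroup V'] [Module k V'] {ρ : Representation k G V}
    {ρ' : Representation k G V'} (e : V ≃ₗ[k] V') (he : ∀ g x, e (ρ g x) = ρ' g (e x))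
    (h : Function.Surjective ρ'.asAlgebraHom) : Function.Surjective ρ.asAlgebraHom := by
  have key (a : MonoidAlgebra k G) (x : V) : e (ρ.asAlgebraHom a x) = ρ'.asAlgebraHom a (e x) := by
    induction a using MonoidAlgebra.induction_on with
    | of g => simp [he]
    | add a b ha hb => simp [ha, hb]
    | smul c a ha => rw [map_smul, map_smul, LinearMap.smul_apply, LinearMap.smul_apply, map_smul, ha]
  intro φ
  obtain ⟨a, ha⟩ := h (e.toLinearMap ∘ₗ φ ∘ₗ e.symm.toLinearMap)
  refine ⟨a, LinearMap.ext fun x => e.injective ?_⟩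
  rw [key, ha]
  simp

/-! ### The cyclotomic tower and the main theorem -/

namespace EllFull

variable (ℓ : ℕ) [Fact ℓ.Prime] {F : Type u} [Field F]

/-- The extension `F(μ_{ℓ^∞})/F` is abelian. -/
theorem commutator_le_cyclotomicGal : commutator (AbsGal F) ≤ cyclotomicGal ℓ F := by
  rw [commutator_def, Subgroup.commutator_le]
  intro σ _ τ _
  rw [cyclotomicGal, IntermediateField.mem_fixingSubgroup_iff]
  intro x hx
  induction hx using IntermediateField.adjoin_induction with
  | mem ζ hζ =>
    obtain ⟨n, hn⟩ := hζ
    have hfin : IsOfFinOrder ζ :=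
      isOfFinOrder_iff_pow_eq_one.mpr ⟨_, pow_pos (Fact.out : ℓ.Prime).pos n, hn⟩
    have hprim := IsPrimitiveRoot.orderOf ζ
    have : NeZero (orderOf ζ) := ⟨hfin.orderOf_pos.ne'⟩
    have hpow (g : AbsGal F) : ∃ i, g ζ = ζ ^ i := by
      obtain ⟨i, -, hi⟩ := hprim.eq_pow_of_pow_eq_one (ξ := g ζ) (by
        rw [← map_pow, pow_orderOf_eq_one, map_one])
      exact ⟨i, hi.symm⟩
    -- Automorphisms act on a root of unity by raising it to powers, and power maps commute.
    have hcomm : σ⁻¹ (τ⁻¹ ζ) = τ⁻¹ (σ⁻¹ ζ) := by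
      obtain ⟨i, hi⟩ := hpow σ⁻¹
      obtain ⟨j, hj⟩ := hpow τ⁻¹
      rw [hi, hj, map_pow, map_pow, hi, hj, ← pow_mul, ← pow_mul, mul_comm]
    have hinv (g : AbsGal F) (z : SeparableClosure F) : g (g⁻¹ z) = z := by
      rw [← AlgEquiv.mul_apply, mul_inv_cancel, AlgEquiv.one_apply]
    rw [commutatorElement_def, AlgEquiv.mul_apply, AlgEquiv.mul_apply, AlgEquiv.mul_apply, hcomm,
      hinv, hinv]
  | algebraMap x => exact AlgEquiv.commutes _ x
  | add x y _ _ hx hy => rw [map_add, hx, hy]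
  | inv x _ hx => rw [map_inv₀, hx]
  | mul x y _ _ hx hy => rw [map_mul, hx, hy]

variable {ℓ}

lemma natCast_separableClosure_ne_zero (hF : ringChar F ≠ ℓ) : (ℓ : SeparableClosure F) ≠ 0 := by
  intro h
  refine hF (CharP.ringChar_of_prime_eq_zero Fact.out ?_)
  rw [← map_natCast (algebraMap F (SeparableClosure F)), map_eq_zero] at h
  exact h

end EllFull

end

theorem mainTheorem7 (ℓ : ℕ) [Fact ℓ.Prime] (hℓ : Odd ℓ) (F : Type*) [Field F]
    (hF : ringChar F ≠ ℓ) (E : WeierstrassCurve F) [E.IsElliptic]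
    (hE : EllFull.ImageContainsSL ℓ E) :
    EllFull.IsFull ℓ E ∧
      EllFull.IsAbsolutelySimple
        ((EllFull.modRep E ℓ).comp (EllFull.cyclotomicGal ℓ F).subtype) := by
  have hne := EllFull.natCast_separableClosure_ne_zero hF
  have : (E.baseChange (SeparableClosure F)).IsElliptic :=
    inferInstanceAs (E.map (algebraMap F (SeparableClosure F))).IsElliptic
  have hdiv : ∀ Q : EllFull.GeomPoint E, ∃ P, ℓ • P = Q := WeierstrassCurve.exists_nsmul_eq hne
  have hfin : Finite (EllFull.Torsion E ℓ) :=
    ((WeierstrassCurve.finite_setOf_nsmul_eq_zero hne).subset fun P hP =>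
      AddSubgroup.torsionBy.nsmul_iff.mp hP).to_subtype
  have hnt : Nontrivial (EllFull.Torsion E ℓ) := by
    obtain ⟨P, hP, hP'⟩ := WeierstrassCurve.exists_ne_zero_nsmul_eq_zero
      (W := E.baseChange (SeparableClosure F)) hne (Fact.out : ℓ.Prime).one_lt
    exact ⟨⟨P, AddSubgroup.torsionBy.nsmul_iff.mpr hP'⟩, 0, fun h => hP (congrArg Subtype.val h)⟩
  have h2 : (2 : ZMod ℓ) ≠ 0 := by
    intro h
    have h' : ((2 : ℕ) : ZMod ℓ) = 0 := h
    rw [ZMod.natCast_eq_zero_iff] at h'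
    have := (Nat.prime_dvd_prime_iff_eq Fact.out Nat.prime_two).mp h'
    subst this
    exact absurd hℓ (by decide)
  have hsurj : Function.Surjective (Representation.asAlgebraHom
      ((EllFull.modRep E ℓ).comp (EllFull.cyclotomicGal ℓ F).subtype)) :=
    Representation.asAlgebraHom_surjective_of_commutator_le h2 (EllFull.modRep E ℓ)
      (fun f v hfv => hE ⟨LinearEquiv.transvection hfv, LinearEquiv.transvection.det_eq_one hfv⟩)
      _ (EllFull.commutator_le_cyclotomicGal ℓ)
  refine ⟨?_, EllFull.isAbsolutelySimple_of_surjective _ hsurj⟩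
  let e := EllFull.TateModule.reductionEquiv hdiv
  have := EllFull.TateModule.finite hdiv
  have : Nontrivial (EllFull.Reduction ℓ (EllFull.TateModule ℓ (EllFull.GeomPoint E))) :=
    e.toEquiv.nontrivial
  have : Module.Finite (ZMod ℓ)
      (EllFull.Reduction ℓ (EllFull.TateModule ℓ (EllFull.GeomPoint E))) :=
    Module.Finite.equiv e.symm
  exact EllFull.isWellRounded_of_surjective _ (Representation.asAlgebraHom_surjective_of_equiv
    (ρ' := (EllFull.modRep E ℓ).comp (EllFull.cyclotomicGal ℓ F).subtype) e
    (fun g x => EllFull.TateModule.reductionEquiv_reductionRep hdiv (EllFull.galAction E)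
      g.1 x) hsurj)
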